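/- Let $(a_n)_{n\ge1}$ be a sequence of positive real numbers. Let $T_1$ be a closed segment of length $a_1$, rooted at one of its two extremities, and recursively, for $n\ge2$, let $T_n$ be the tree obtained from $T_{n-1}$ by gluing one extremity of a closed segment of length $a_n$ on a point which, given $T_{n-1}$, is chosen uniformly on $T_{n-1}$ (i.e. according to the normalized length measure). Let $d$ denote the length metric of $T_n$. For each $n\ge1$, given $T_n$, let $X_n$ be a uniformly chosen point of $T_n$, and let $D_n=d(X_n,\mathrm{root})$. Assume that $(a_n)$ is regularly varying with index $\alpha\ge0$, i.e. $a_{\lfloor cn\rfloor}/a_n\to c^{\alpha}$ as $n\to\infty$ for every $c>0$. Then, as $n\to\infty$: 1. If $\alpha>0$, then $$\frac{D_n}{\sum_{i=1}^n i^{-1}a_i}\longrightarrow \alpha\,\xi_{(\alpha)}\quad\text{in distribution},$$ where $\xi_{(\alpha)}$ is a real random variable whose law exists and is uniquely characterized by $$\mathbb E\big[e^{\lambda\xi_{(\alpha)}}\big]=\exp\Big(\frac{\alpha+1}{\alpha}\int_0^1\big(e^{\lambda u}-1\big)\frac{1-u}{u}\,\mathrm du\Big),\qquad \lambda\in\mathbb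 R.$$ 2. If $\alpha=0$ and $\sum_{i\ge1} i^{-1}a_i=\infty$, then $$\frac{D_n}{\sum_{i=1}^n i^{-1}a_i}\longrightarrow \frac12\quad\text{in probability}.$$ 3. If $\alpha=0$ and $\sum_{i\ge1} i^{-1}a_i<\infty$, then there is an almost surely positive random variable $D_\infty$ with finite expectation such that $$\frac{D_n}{\sum_{i=1}^n i^{-1}a_i}\longrightarrow D_\infty\quad\text{in distribution}.$$ -/

import Mathlib

open MeasureTheory ProbabilityTheory Filter Topology

noncomputable section

namespace SegmentGluing

/-- A positive sequence `(a n)_{n ≥ 1}` is regularly varying with index `α` if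
`a ⌊c n⌋ / a n → c ^ α` for every `c > 0`. (The value `a 0` plays no role.) -/
def RegularlyVarying (a : ℕ → ℝ) (α : ℝ) : Prop :=
  ∀ c : ℝ, 0 < c → Tendsto (fun n : ℕ => a ⌊c * n⌋₊ / a n) atTop (𝓝 (c ^ α))

/-- The normalizing sum `∑_{i=1}^n i⁻¹ a i`. -/
def weightedSum (a : ℕ → ℝ) (n : ℕ) : ℝ := ∑ i ∈ Finset.Icc 1 n, (i : ℝ)⁻¹ * a i

/-- The point of the `i`-th segment at distance `t ∈ [0, a i]` from its glued extremity is written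
`(i, t)`. Hence `T_n` is the set of `(i, t)` with `1 ≤ i ≤ n` and `0 ≤ t ≤ a i`, where the
extremity `(i + 1, 0)` is identified with the point `y i` of `T_i` on which the segment of index
`i + 1` is glued, `i ≥ 1` (these two points are at distance `0` for `treeDist`). -/
abbrev Pt : Type := ℕ × ℝ

/-- The length metric of `T_n`, when the segment of index `i + 1` is glued on `y i`, `i ≥ 1`.
It extends the metric of `T_{n-1}`; two points of the last segment are at their distance along
this segment; and the path between a point `(n, t)` of the last segment and a point `q` of
`T_{n-1}` runs through the gluing point. -/
def treeDist (y : ℕ → Pt) : ℕ → Pt → Pt → ℝ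
  | 0, _, _ => 0
  | n + 1, p, q =>
    if p.1 = n + 1 then
      if q.1 = n + 1 then |p.2 - q.2| else p.2 + treeDist y n (y n) q
    else
      if q.1 = n + 1 then treeDist y n p (y n) + q.2 else treeDist y n p q

/-- The root: the first extremity of the first segment. -/
def root : Pt := (1, 0)

/-- The length measure of `T_n`. -/
def lengthMeasure (a : ℕ → ℝ) (n : ℕ) : Measure Pt :=
  ∑ i ∈ Finset.Icc 1 n, (volume.restrict (Set.Icc 0 (a i))).map (fun t : ℝ => ((i, t) : Pt))

/-- The uniform probability measure on `T_n`: the length measure divided by its total mass. -/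
def uniformLaw (a : ℕ → ℝ) (n : ℕ) : Measure Pt :=
  (lengthMeasure a n Set.univ)⁻¹ • lengthMeasure a n

variable {Ω : Type*} [MeasurableSpace Ω]

/-- Given the tree `T_n`, that is, given the gluing points `Y 1, …, Y (n - 1)`, the point `Z` is
uniform on `T_n`. (In the coordinates `(i, t)` the uniform measure of `T_n` does not depend on the
positions of the gluing points, so the conditional law is a constant kernel.) -/
def UniformOnTree (a : ℕ → ℝ) (P : Measure Ω) (Y : ℕ → Ω → Pt) (n : ℕ) (Z : Ω → Pt) : Prop :=
  HasCondDistrib Z (fun ω (i : Finset.Ico 1 n) => Y i ω)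
    (Kernel.const (Finset.Ico 1 n → Pt) (uniformLaw a n)) P

/-- `Y` is a sequence of gluing points: for every `n ≥ 1`, the segment of index `n + 1` is glued on
`Y n`, which is uniform on `T_n` given `T_n`. -/
def IsGluing (a : ℕ → ℝ) (P : Measure Ω) (Y : ℕ → Ω → Pt) : Prop :=
  ∀ n, 1 ≤ n → UniformOnTree a P Y n (Y n)

/-- The height `D_n = d(X_n, root)` of the marked point `X n` of `T_n`. -/
def height (Y X : ℕ → Ω → Pt) (n : ℕ) (ω : Ω) : ℝ :=
  treeDist (fun i => Y i ω) n (X n ω) root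

/-- `φ_α(t) = (α + 1) / α * ∫_0^1 (exp (t u) - 1) (1 - u) / u du`. -/
def phi (α t : ℝ) : ℝ :=
  (α + 1) / α * ∫ u in (0 : ℝ)..1, (Real.exp (t * u) - 1) * ((1 - u) / u)

/-- `ν` is the law of `ξ_(α)`: its moment generating function is `exp ∘ φ_α` on all of `ℝ`.
(As `mgf` is `0` where the exponential is not integrable, this contains the finiteness of all
exponential moments.) -/
def IsXiLaw (α : ℝ) (ν : ProbabilityMeasure ℝ) : Prop :=
  ∀ t : ℝ, mgf id (ν : Measure ℝ) t = Real.exp (phi α t)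

end SegmentGluing

end

namespace SegmentGluing

/-!
Write `p i` for the probability that a uniform point of `T_i` lies on the last segment, and `S_n`
for `weightedSum a n`. A uniform point of `T_n` is, with probability `1 - p n`, a uniform point of
`T_{n-1}`; otherwise it is at a uniform distance in `[0, a n]` from the gluing point, itself
uniform on `T_{n-1}`. Hence `D_n` has the law of `∑ i ≤ n, B_i * U_i * a i` with independent
Bernoulli(`p i`) variables `B_i` and uniform variables `U_i`, and `E[exp (t D_n / S_n)]` is an
explicit product over `i ≤ n`.

Regular variation gives `n * p n → α + 1` and `a n / S_n → α`. If `α > 0`, then the logarithm of the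
product is a Riemann sum, dominated thanks to Potter's bound, and converges to `φ_α(α t)`. If
`α = 0` and `S_n → ∞`, every `a i / S_n` is negligible and the logarithm is asymptotically the
weighted mean `(t / 2) (∑ p i * a i) / S_n → t / 2`. If `α = 0` and `S_n` converges, the logarithm
converges as a dominated series; the factor `i = 1` makes the limit vanish as `t → -∞`, so that
the limit law has no mass on `(-∞, 0]`. Convergence of the moment generating functions at every
real `t` implies convergence in distribution.
-/

section WeakConvergence

variable {E : Type*} [MeasurableSpace E] [TopologicalSpace E] [OpensMeasurableSpace E]
  [HasOuterApproxClosed E] {μ : ℕ → ProbabilityMeasure E} {ν : ProbabilityMeasure E}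
  {f : E → ℝ} {m m₂ : ℝ}

lemma integrable_and_integral_le_of_tendsto (hμ : Tendsto μ atTop (𝓝 ν)) (hf : Continuous f)
    (hf₀ : 0 ≤ f) (hint : ∀ n, Integrable f (μ n : Measure E))
    (hm : Tendsto (fun n => ∫ x, f x ∂(μ n : Measure E)) atTop (𝓝 m)) :
    Integrable f (ν : Measure E) ∧ ∫ x, f x ∂(ν : Measure E) ≤ m := by
  have hm₀ : 0 ≤ m := ge_of_tendsto' hm fun n => integral_nonneg hf₀
  have hfatou : ∫⁻ x, ENNReal.ofReal (f x) ∂(ν : Measure E) ≤ ENNReal.ofReal m := by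
    refine (lintegral_le_liminf_lintegral_of_forall_isOpen_measure_le_liminf_measure hf hf₀
      fun _ hG => ProbabilityMeasure.le_liminf_measure_open_of_tendsto hμ hG).trans_eq ?_
    simp_rw [← fun n => ofReal_integral_eq_lintegral_ofReal (hint n) (ae_of_all _ hf₀)]
    exact (ENNReal.tendsto_ofReal hm).liminf_eq
  have hfν : Integrable f (ν : Measure E) := by
    refine ⟨hf.measurable.aestronglyMeasurable, ?_⟩
    rw [hasFiniteIntegral_iff_ofReal (ae_of_all _ hf₀)]
    exact hfatou.trans_lt ENNReal.ofReal_lt_top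
  rw [← ofReal_integral_eq_lintegral_ofReal hfν (ae_of_all _ hf₀),
    ENNReal.ofReal_le_ofReal_iff hm₀] at hfatou
  exact ⟨hfν, hfatou⟩

lemma integral_eq_of_tendsto_of_tendsto_sq (hμ : Tendsto μ atTop (𝓝 ν)) (hf : Continuous f)
    (hf₀ : 0 ≤ f) (hint : ∀ n, Integrable f (μ n : Measure E))
    (hint₂ : ∀ n, Integrable (fun x => f x ^ 2) (μ n : Measure E))
    (hm : Tendsto (fun n => ∫ x, f x ∂(μ n : Measure E)) atTop (𝓝 m))
    (hm₂ : Tendsto (fun n => ∫ x, f x ^ 2 ∂(μ n : Measure E)) atTop (𝓝 m₂)) :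
    ∫ x, f x ∂(ν : Measure E) = m := by
  obtain ⟨hfν, hle⟩ := integrable_and_integral_le_of_tendsto hμ hf hf₀ hint hm
  obtain ⟨hfν₂, -⟩ := integrable_and_integral_le_of_tendsto hμ (hf.pow 2) (fun x => sq_nonneg (f x))
    hint₂ hm₂
  have hexpand : ∀ (ρ : ProbabilityMeasure E) (K : ℝ), Integrable f (ρ : Measure E) →
      Integrable (fun x => f x ^ 2) (ρ : Measure E) →
      Integrable (fun x => (f x - K) ^ 2) (ρ : Measure E) ∧
        ∫ x, (f x - K) ^ 2 ∂(ρ : Measure E) =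
          ∫ x, f x ^ 2 ∂(ρ : Measure E) - 2 * K * ∫ x, f x ∂(ρ : Measure E) + K ^ 2 := by
    intro ρ K h₁ h₂
    have hsq : (fun x => (f x - K) ^ 2) = fun x => f x ^ 2 - 2 * K * f x + K ^ 2 := by
      ext x; ring
    have h₁' := h₁.const_mul (2 * K)
    have hdiff : Integrable (fun x => f x ^ 2 - 2 * K * f x) (ρ : Measure E) := h₂.sub h₁'
    rw [hsq, integral_add hdiff (integrable_const _), integral_sub h₂ h₁', integral_const_mul,
      integral_const, probReal_univ, one_smul]
    exact ⟨hdiff.add (integrable_const _), rfl⟩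
  -- Fatou's lemma for `(f - K) ^ 2` is a lower bound for `∫ f`, whose error vanishes as `K → ∞`.
  have hge : ∀ K : ℝ, 2 * (m - ∫ x, f x ∂(ν : Measure E)) * K ≤ m₂ := by
    intro K
    have hlim : Tendsto (fun n => ∫ x, (f x - K) ^ 2 ∂(μ n : Measure E)) atTop
        (𝓝 (m₂ - 2 * K * m + K ^ 2)) := by
      simp_rw [fun n => (hexpand (μ n) K (hint n) (hint₂ n)).2]
      exact (hm₂.sub (hm.const_mul _)).add_const _
    have hcont : Continuous fun x => (f x - K) ^ 2 := by fun_prop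
    have hK := (integrable_and_integral_le_of_tendsto hμ hcont
      (fun x => sq_nonneg (f x - K)) (fun n => (hexpand (μ n) K (hint n) (hint₂ n)).1) hlim).2
    rw [(hexpand ν K hfν hfν₂).2] at hK
    have h₂ : 0 ≤ ∫ x, f x ^ 2 ∂(ν : Measure E) := integral_nonneg fun x => sq_nonneg (f x)
    linarith
  refine le_antisymm hle (not_lt.1 fun hlt => ?_)
  have hpos : 0 < 2 * (m - ∫ x, f x ∂(ν : Measure E)) := by linarith
  have hK := hge ((m₂ + 1) / (2 * (m - ∫ x, f x ∂(ν : Measure E))))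
  rw [mul_div_cancel₀ _ hpos.ne'] at hK
  linarith

end WeakConvergence

lemma isTightMeasureSet_of_mgf_le {S : Set (Measure ℝ)} {C : ℝ}
    (hprob : ∀ μ ∈ S, IsProbabilityMeasure μ)
    (hint : ∀ μ ∈ S, ∀ t, Integrable (fun x : ℝ => Real.exp (t * x)) μ)
    (hC : ∀ μ ∈ S, mgf id μ 1 + mgf id μ (-1) ≤ C) : IsTightMeasureSet S := by
  refine isTightMeasureSet_of_tendsto_measure_norm_gt ?_
  have hzero : Tendsto (fun r : ℝ => ENNReal.ofReal (Real.exp (-r) * C)) atTop (𝓝 0) := by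
    simpa using ENNReal.tendsto_ofReal (Real.tendsto_exp_neg_atTop_nhds_zero.mul_const C)
  refine tendsto_of_tendsto_of_tendsto_of_le_of_le tendsto_const_nhds hzero
    (fun _ => zero_le) fun r => iSup₂_le fun μ hμ => ?_
  have := hprob μ hμ
  have hupper := measure_ge_le_exp_mul_mgf (X := id) r zero_le_one (hint μ hμ 1)
  have hlower := measure_le_le_exp_mul_mgf (X := id) (-r) (by norm_num) (hint μ hμ (-1))
  rw [← ofReal_measureReal]
  refine ENNReal.ofReal_le_ofReal ?_
  calc μ.real {x | r < ‖x‖}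
      ≤ μ.real ({x | r ≤ id x} ∪ {x | id x ≤ -r}) := by
        refine measureReal_mono fun x hx => ?_
        rcases lt_abs.1 (show r < |x| from hx) with h | h
        · exact Or.inl h.le
        · exact Or.inr (le_neg_of_le_neg h.le)
    _ ≤ μ.real {x | r ≤ id x} + μ.real {x | id x ≤ -r} := measureReal_union_le _ _
    _ ≤ Real.exp (-r) * mgf id μ 1 + Real.exp (-r) * mgf id μ (-1) :=
        add_le_add (by simpa using hupper) (by simpa using hlower)
    _ ≤ Real.exp (-r) * C := by
        rw [← mul_add]
        exact mul_le_mul_of_nonneg_left (hC μ hμ) (Real.exp_nonneg _)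

lemma measure_eq_of_mgf_eq {μ ν : Measure ℝ} [IsProbabilityMeasure μ] [IsProbabilityMeasure ν]
    (hμ : ∀ t, Integrable (fun x : ℝ => Real.exp (t * x)) μ)
    (h : ∀ t, mgf id μ t = mgf id ν t) : μ = ν := by
  have huniv : integrableExpSet id μ = Set.univ := Set.eq_univ_of_forall hμ
  refine Measure.ext_of_complexMGF_id_eq (funext fun z => ?_)
  exact eqOn_complexMGF_of_mgf (funext h) (by simp [huniv])

section MGFConvergence

variable {μ : ℕ → ProbabilityMeasure ℝ} {ν : ProbabilityMeasure ℝ} {M : ℝ → ℝ}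

lemma integrable_exp_and_mgf_eq_of_tendsto
    (hint : ∀ n t, Integrable (fun x : ℝ => Real.exp (t * x)) (μ n : Measure ℝ))
    (hM : ∀ t, Tendsto (fun n => mgf id (μ n : Measure ℝ) t) atTop (𝓝 (M t)))
    (hμ : Tendsto μ atTop (𝓝 ν)) (t : ℝ) :
    Integrable (fun x : ℝ => Real.exp (t * x)) (ν : Measure ℝ) ∧
      mgf id (ν : Measure ℝ) t = M t := by
  have hcont : Continuous fun x : ℝ => Real.exp (t * x) := by fun_prop
  have hsq : ∀ x : ℝ, Real.exp (2 * t * x) = Real.exp (t * x) ^ 2 := fun x => by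
    rw [← Real.exp_nat_mul]; push_cast; ring_nf
  have hint₂ := fun n => hint n (2 * t)
  have hM₂ := hM (2 * t)
  simp only [mgf, id, hsq] at hint₂ hM₂
  exact ⟨(integrable_and_integral_le_of_tendsto hμ hcont (fun x => (Real.exp_pos _).le)
      (hint · t) (hM t)).1,
    integral_eq_of_tendsto_of_tendsto_sq hμ hcont (fun x => (Real.exp_pos _).le)
      (hint · t) hint₂ (hM t) hM₂⟩

theorem exists_tendsto_of_tendsto_mgf
    (hint : ∀ n t, Integrable (fun x : ℝ => Real.exp (t * x)) (μ n : Measure ℝ))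
    (hM : ∀ t, Tendsto (fun n => mgf id (μ n : Measure ℝ) t) atTop (𝓝 (M t))) :
    ∃ ν : ProbabilityMeasure ℝ, Tendsto μ atTop (𝓝 ν) ∧
      ∀ t, Integrable (fun x : ℝ => Real.exp (t * x)) (ν : Measure ℝ) ∧
        mgf id (ν : Measure ℝ) t = M t := by
  obtain ⟨C, hC⟩ := ((hM 1).add (hM (-1))).bddAbove_range
  have hcompact : IsCompact (closure (Set.range μ)) := by
    refine isCompact_closure_of_isTightMeasureSet (isTightMeasureSet_of_mgf_le (C := C) ?_ ?_ ?_)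
    · rintro _ ⟨ρ, -, rfl⟩
      infer_instance
    · rintro _ ⟨_, ⟨n, rfl⟩, rfl⟩
      exact hint n
    · rintro _ ⟨_, ⟨n, rfl⟩, rfl⟩
      exact hC ⟨n, rfl⟩
  have hmem : ∀ n, μ n ∈ closure (Set.range μ) := fun n => subset_closure ⟨n, rfl⟩
  have hcluster : ∀ ρ, MapClusterPt ρ atTop μ →
      ∀ t, Integrable (fun x : ℝ => Real.exp (t * x)) (ρ : Measure ℝ) ∧
        mgf id (ρ : Measure ℝ) t = M t := by
    intro ρ hρ
    obtain ⟨ψ, hψ, hlim⟩ := hρ.tendsto_subseq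
    exact integrable_exp_and_mgf_eq_of_tendsto (fun n => hint (ψ n))
      (fun t => (hM t).comp hψ.tendsto_atTop) hlim
  obtain ⟨ν, -, hν⟩ := hcompact.exists_mapClusterPt
    (tendsto_principal.2 (Eventually.of_forall hmem) : Tendsto μ atTop _)
  refine ⟨ν, hcompact.tendsto_nhds_of_unique_mapClusterPt (Eventually.of_forall hmem)
    fun ρ _ hρ => ?_, hcluster ν hν⟩
  have hlaw : (ρ : Measure ℝ) = (ν : Measure ℝ) :=
    measure_eq_of_mgf_eq (fun t => (hcluster ρ hρ t).1) fun t =>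
      (hcluster ρ hρ t).2.trans (hcluster ν hν t).2.symm
  exact Subtype.ext hlaw

end MGFConvergence

section InDistribution

variable {Ω : ℕ → Type*} {_ : ∀ n, MeasurableSpace (Ω n)} {P : ∀ n, Measure (Ω n)}
  [∀ n, IsProbabilityMeasure (P n)] {X : ∀ n, Ω n → ℝ}

theorem exists_tendstoInDistribution_of_tendsto_mgf {M : ℝ → ℝ}
    (hX : ∀ n, AEMeasurable (X n) (P n))
    (hint : ∀ n t, Integrable (fun ω => Real.exp (t * X n ω)) (P n))
    (hM : ∀ t, Tendsto (fun n => mgf (X n) (P n) t) atTop (𝓝 (M t))) :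
    ∃ ν : ProbabilityMeasure ℝ,
      TendstoInDistribution X atTop (fun x : ℝ => x) P (ν : Measure ℝ) ∧
      ∀ t, Integrable (fun x : ℝ => Real.exp (t * x)) (ν : Measure ℝ) ∧
        mgf id (ν : Measure ℝ) t = M t := by
  obtain ⟨ν, hν, hmgf⟩ := exists_tendsto_of_tendsto_mgf
    (μ := fun n => ⟨(P n).map (X n), Measure.isProbabilityMeasure_map (hX n)⟩) (M := M)
    (fun n t => (integrable_map_measure (by fun_prop) (hX n)).2 (hint n t))
    (fun t => by simpa only [ProbabilityMeasure.coe_mk, mgf_id_map (hX _)] using hM t)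
  have hid : ν = ⟨(ν : Measure ℝ).map fun x => x, Measure.isProbabilityMeasure_map (by fun_prop)⟩ :=
    Subtype.ext Measure.map_id'.symm
  exact ⟨ν, ⟨hX, by fun_prop, hid ▸ hν⟩, hmgf⟩

theorem tendstoInDistribution_of_tendsto_mgf {Ω' : Type*} [MeasurableSpace Ω'] {P' : Measure Ω'}
    [IsProbabilityMeasure P'] {Z : Ω' → ℝ} (hX : ∀ n, AEMeasurable (X n) (P n))
    (hint : ∀ n t, Integrable (fun ω => Real.exp (t * X n ω)) (P n)) (hZ : AEMeasurable Z P')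
    (hM : ∀ t, Tendsto (fun n => mgf (X n) (P n) t) atTop (𝓝 (mgf Z P' t))) :
    TendstoInDistribution X atTop Z P P' := by
  obtain ⟨ν, hν, hmgf⟩ := exists_tendstoInDistribution_of_tendsto_mgf hX hint hM
  have := Measure.isProbabilityMeasure_map hZ
  have hlaw : (ν : Measure ℝ) = P'.map Z :=
    measure_eq_of_mgf_eq (fun t => (hmgf t).1) fun t => by rw [(hmgf t).2, mgf_id_map hZ]
  refine ⟨hX, hZ, ?_⟩
  simpa only [Measure.map_id', hlaw] using hν.tendsto

end InDistribution

theorem tendstoInMeasure_of_tendstoInDistribution_const {ι Ω Ω' E : Type*} [MeasurableSpace Ω]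
    [MeasurableSpace Ω'] {P : Measure Ω} {P' : Measure Ω'} [IsProbabilityMeasure P]
    [IsProbabilityMeasure P'] [PseudoMetricSpace E] [MeasurableSpace E] [OpensMeasurableSpace E]
    {l : Filter ι} {X : ι → Ω → E} {c : E}
    (h : TendstoInDistribution X l (fun _ => c) (fun _ => P) P') :
    TendstoInMeasure P X l fun _ => c := by
  refine tendstoInMeasure_iff_dist.2 fun ε hε => ?_
  have hclosed : IsClosed {x : E | ε ≤ dist x c} :=
    isClosed_le continuous_const (continuous_id.dist continuous_const)
  have hnull : P'.map (fun _ : Ω' => c) {x : E | ε ≤ dist x c} = 0 := by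
    simp [Measure.dirac_apply' c hclosed.measurableSet, hε]
  have hlim := ProbabilityMeasure.tendsto_measure_of_null_frontier_of_tendsto' h.tendsto
    (measure_mono_null hclosed.frontier_subset hnull)
  simp only [ProbabilityMeasure.coe_mk, hnull] at hlim
  refine hlim.congr fun i => ?_
  rw [Measure.map_apply_of_aemeasurable (h.forall_aemeasurable i) hclosed.measurableSet]
  rfl

lemma ae_pos_of_tendsto_mgf_atBot {Ω : Type*} [MeasurableSpace Ω] {P : Measure Ω}
    [IsFiniteMeasure P] {X : Ω → ℝ}
    (hint : ∀ t, Integrable (fun ω => Real.exp (t * X ω)) P)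
    (hlim : Tendsto (mgf X P) atBot (𝓝 0)) : ∀ᵐ ω ∂P, 0 < X ω := by
  have hle : P.real {ω | X ω ≤ 0} ≤ 0 := by
    refine ge_of_tendsto hlim ?_
    filter_upwards [eventually_le_atBot 0] with t ht
    simpa using measure_le_le_exp_mul_mgf 0 ht (hint t)
  simpa only [ae_iff, not_lt] using
    (measureReal_eq_zero_iff).1 (hle.antisymm measureReal_nonneg)

section Floor

lemma tendsto_floor_mul_atTop {c : ℝ} (hc : 0 < c) :
    Tendsto (fun n : ℕ => ⌊c * n⌋₊) atTop atTop :=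
  tendsto_nat_floor_atTop.comp (tendsto_natCast_atTop_atTop.const_mul_atTop hc)

lemma tendsto_floor_mul_div {c : ℝ} (hc : 0 ≤ c) :
    Tendsto (fun n : ℕ => (⌊c * n⌋₊ : ℝ) / n) atTop (𝓝 c) :=
  (tendsto_nat_floor_mul_div_atTop hc).comp tendsto_natCast_atTop_atTop

lemma tendsto_floor_mul_add_one_div {c : ℝ} (hc : 0 ≤ c) :
    Tendsto (fun n : ℕ => ((⌊c * n⌋₊ + 1 : ℕ) : ℝ) / n) atTop (𝓝 c) := by
  simpa only [Nat.cast_add_one, add_div, one_div, add_zero] using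
    (tendsto_floor_mul_div hc).add tendsto_inv_atTop_nhds_zero_nat

lemma floor_inv_mul_floor_mul_succ {c : ℝ} (hc : 1 < c) (hirr : Irrational c) (n : ℕ) :
    ⌊c⁻¹ * (⌊c * (n + 1 : ℕ)⌋₊ : ℝ)⌋₊ = n := by
  have hc₀ : 0 < c := one_pos.trans hc
  set m := ⌊c * (n + 1 : ℕ)⌋₊
  have hle : (m : ℝ) ≤ c * (n + 1 : ℕ) := Nat.floor_le (by positivity)
  have hlt : (m : ℝ) < c * (n + 1 : ℕ) :=
    hle.lt_of_ne ((hirr.mul_natCast n.succ_ne_zero).ne_nat m).symm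
  have hgt : c * (n + 1 : ℕ) < m + 1 := Nat.lt_floor_add_one _
  push_cast at hlt hgt
  rw [Nat.floor_eq_iff (by positivity), inv_mul_eq_div, le_div_iff₀ hc₀, div_lt_iff₀ hc₀]
  constructor <;> nlinarith

lemma measurable_apply_floor_mul {β : Type*} [MeasurableSpace β] (b : ℕ → β) (c : ℝ) :
    Measurable fun v : ℝ => b ⌊v * c⌋₊ :=
  measurable_from_nat.comp (Nat.measurable_floor.comp (measurable_id.mul_const c))

end Floor

section RegularVariation

variable {a : ℕ → ℝ} {α : ℝ}

lemma RegularlyVarying.mul_rpow (h : RegularlyVarying a α) (ρ : ℝ) :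
    RegularlyVarying (fun n => a n * (n : ℝ) ^ ρ) (α + ρ) := by
  intro c hc
  have hlim := (h c hc).mul ((tendsto_floor_mul_div hc.le).rpow_const (p := ρ) (Or.inl hc.ne'))
  rw [← Real.rpow_add hc] at hlim
  refine hlim.congr fun n => ?_
  rw [Real.div_rpow (by positivity) (by positivity), mul_div_mul_comm]

lemma mul_rpow_pos (ha : ∀ n, 1 ≤ n → 0 < a n) (ρ : ℝ) (n : ℕ) (hn : 1 ≤ n) :
    0 < a n * (n : ℝ) ^ ρ :=
  mul_pos (ha n hn) (Real.rpow_pos_of_pos (Nat.cast_pos.2 hn) ρ)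

lemma RegularlyVarying.tendsto_succ_div (ha : ∀ n, 1 ≤ n → 0 < a n) (h : RegularlyVarying a α) :
    Tendsto (fun n => a (n + 1) / a n) atTop (𝓝 1) := by
  set c : ℝ := √2
  have hc : 1 < c := Real.one_lt_sqrt_two
  have hc₀ : 0 < c := one_pos.trans hc
  -- Since `c` is irrational, `⌊c⁻¹ * ⌊c * (n + 1)⌋⌋ = n`: going up by `c` and back loses one step.
  have hup := (h c hc₀).comp (tendsto_add_atTop_nat 1)
  have hdown := ((h c⁻¹ (inv_pos.2 hc₀)).comp (tendsto_floor_mul_atTop hc₀)).comp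
    (tendsto_add_atTop_nat 1)
  have hlim := (hup.mul hdown).inv₀ (by positivity)
  rw [Real.inv_rpow hc₀.le, mul_inv_cancel₀ (by positivity), inv_one] at hlim
  refine hlim.congr' ?_
  filter_upwards [(tendsto_add_atTop_nat 1).eventually
    ((tendsto_floor_mul_atTop hc₀).eventually_ge_atTop 1), eventually_ge_atTop 1] with n hm hn
  have hfloor : a ⌊c * (n + 1 : ℕ)⌋₊ ≠ 0 := (ha _ hm).ne'
  have hn₀ : a n ≠ 0 := (ha n hn).ne'
  simp only [Function.comp, floor_inv_mul_floor_mul_succ hc irrational_sqrt_two]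
  field_simp

lemma RegularlyVarying.tendsto_floor_succ (ha : ∀ n, 1 ≤ n → 0 < a n) (h : RegularlyVarying a α)
    {c : ℝ} (hc : 0 < c) :
    Tendsto (fun n : ℕ => a (⌊c * n⌋₊ + 1) / a n) atTop (𝓝 (c ^ α)) := by
  have hlim := ((h.tendsto_succ_div ha).comp (tendsto_floor_mul_atTop hc)).mul (h c hc)
  rw [one_mul] at hlim
  refine hlim.congr' ?_
  filter_upwards [(tendsto_floor_mul_atTop hc).eventually_ge_atTop 1] with n hn
  exact div_mul_div_cancel₀ (ha _ hn).ne'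

end RegularVariation

section Potter

variable {b : ℕ → ℝ} {β : ℝ}

lemma exists_mem_mul_mem_of_lt_volume {V : Set ℝ} (hV : MeasurableSet V)
    (hsub : V ⊆ Set.Icc 1 3) (hvol : 5 / 3 < volume.real V) {r : ℝ} (hr₁ : 1 ≤ r) (hr₂ : r ≤ 2) :
    ∃ v ∈ V, r * v ∈ V := by
  have hr₀ : 0 < r := one_pos.trans_le hr₁
  by_contra! hnone
  set W : Set ℝ := (fun v => r * v) ⁻¹' V
  have hdisj : Disjoint V W := Set.disjoint_left.2 hnone
  have hunion : V ∪ W ⊆ Set.Icc r⁻¹ 3 := by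
    refine Set.union_subset (hsub.trans (Set.Icc_subset_Icc_left (inv_le_one_of_one_le₀ hr₁))) ?_
    intro v hv
    obtain ⟨h₁, h₃⟩ := hsub hv
    exact ⟨(inv_le_iff_one_le_mul₀' hr₀).2 h₁, by nlinarith⟩
  have hW : volume.real W = r⁻¹ * volume.real V := by
    simp only [W, measureReal_def, Real.volume_preimage_mul_left hr₀.ne', ENNReal.toReal_mul,
      abs_of_pos (inv_pos.2 hr₀), ENNReal.toReal_ofReal (inv_pos.2 hr₀).le]
  have hfinite : ∀ s ⊆ V ∪ W, volume s ≠ ⊤ := fun s hs =>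
    ((measure_mono (hs.trans hunion)).trans_lt measure_Icc_lt_top).ne
  have hle : volume.real V + r⁻¹ * volume.real V ≤ 3 - r⁻¹ := by
    rw [← hW, ← measureReal_union hdisj (hV.preimage (measurable_const_mul r))
      (hfinite V Set.subset_union_left) (hfinite W Set.subset_union_right),
      ← Real.volume_real_Icc_of_le ((inv_le_one_of_one_le₀ hr₁).trans (by norm_num))]
    exact measureReal_mono hunion measure_Icc_lt_top.ne
  have hr_inv : 1 / 2 ≤ r⁻¹ := by
    rw [one_div]
    exact inv_anti₀ hr₀ hr₂
  nlinarith

/-- The ratios `v ∈ [1, 3]` such that `b ⌊v n⌋` and `b n` are within a factor `N` of each other for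
all `n > N`. Regular variation only says that every `v` lies in one of these sets; the uniformity
in `v` needed for Potter's bound is recovered by measure. -/
def comparableRatios (b : ℕ → ℝ) (N : ℕ) : Set ℝ :=
  {v ∈ Set.Icc 1 3 | ∀ n > N, b ⌊v * (n : ℕ)⌋₊ ≤ N * b n ∧ b n ≤ N * b ⌊v * (n : ℕ)⌋₊}

lemma measurableSet_comparableRatios (b : ℕ → ℝ) (N : ℕ) :
    MeasurableSet (comparableRatios b N) := by
  have hb := fun n : ℕ => measurable_apply_floor_mul b n
  simp only [comparableRatios, Set.ofPred_and, Set.ofPred_forall]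
  refine measurableSet_Icc.inter (.iInter fun n => .iInter fun _ => .inter ?_ ?_)
  · exact measurableSet_le (hb n) measurable_const
  · exact measurableSet_le measurable_const ((hb n).const_mul _)

lemma one_le_floor_mul {v : ℝ} (hv : 1 ≤ v) {n : ℕ} (hn : 1 ≤ n) : 1 ≤ ⌊v * n⌋₊ :=
  Nat.le_floor (by
    have : (1 : ℝ) ≤ n := Nat.one_le_cast.2 hn
    push_cast
    nlinarith)

lemma monotone_comparableRatios (hb : ∀ n, 1 ≤ n → 0 < b n) : Monotone (comparableRatios b) := by
  rintro N N' hN v ⟨hv, hcmp⟩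
  refine ⟨hv, fun n hn => ?_⟩
  have hNN' : (N : ℝ) ≤ N' := Nat.cast_le.2 hN
  obtain ⟨h₁, h₂⟩ := hcmp n (hN.trans_lt hn)
  have hn₁ : 1 ≤ n := by omega
  exact ⟨h₁.trans (mul_le_mul_of_nonneg_right hNN' (hb n hn₁).le),
    h₂.trans (mul_le_mul_of_nonneg_right hNN' (hb _ (one_le_floor_mul hv.1 hn₁)).le)⟩

lemma RegularlyVarying.iUnion_comparableRatios (hb : ∀ n, 1 ≤ n → 0 < b n)
    (h : RegularlyVarying b β) : ⋃ N, comparableRatios b N = Set.Icc 1 3 := by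
  refine Set.Subset.antisymm (Set.iUnion_subset fun N v hv => hv.1) fun v hv => ?_
  have hv₀ : 0 < v := one_pos.trans_le hv.1
  have hlim := h v hv₀
  have hinv := hlim.inv₀ (Real.rpow_pos_of_pos hv₀ β).ne'
  obtain ⟨C, hC⟩ := hlim.bddAbove_range
  obtain ⟨C', hC'⟩ := hinv.bddAbove_range
  obtain ⟨N, hN⟩ := exists_nat_ge (max C C')
  refine Set.mem_iUnion.2 ⟨N, hv, fun n hn => ?_⟩
  have hn₁ : 1 ≤ n := by omega
  have hle := (hC ⟨n, rfl⟩).trans ((le_max_left C C').trans hN)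
  have hge : (b ⌊v * n⌋₊ / b n)⁻¹ ≤ N :=
    (hC' ⟨n, rfl⟩).trans ((le_max_right C C').trans hN)
  rw [div_le_iff₀ (hb n hn₁)] at hle
  rw [inv_div, div_le_iff₀ (hb _ (one_le_floor_mul hv.1 hn₁))] at hge
  exact ⟨hle, hge⟩

lemma RegularlyVarying.exists_le_mul_of_le_two_mul (hb : ∀ n, 1 ≤ n → 0 < b n)
    (h : RegularlyVarying b β) :
    ∃ C : ℝ, ∃ N : ℕ, 0 < C ∧ ∀ n i : ℕ, N ≤ i → i ≤ n → n ≤ 2 * i → b i ≤ C * b n := by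
  have hlim := tendsto_measure_iUnion_atTop (μ := volume) (monotone_comparableRatios hb)
  rw [h.iUnion_comparableRatios hb, Real.volume_Icc] at hlim
  have hlimReal := (ENNReal.tendsto_toReal ENNReal.ofReal_ne_top).comp hlim
  rw [ENNReal.toReal_ofReal (by norm_num)] at hlimReal
  obtain ⟨N, hN, hN₁⟩ := ((hlimReal.eventually_const_lt (u := 5 / 3) (by norm_num)).and
    (eventually_ge_atTop 1)).exists
  refine ⟨N * N, N + 1, by positivity, fun n i hNi hin hni => ?_⟩
  have hi₀ : (0 : ℝ) < i := Nat.cast_pos.2 (by omega)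
  have hratio₁ : 1 ≤ (n / i : ℝ) := (one_le_div hi₀).2 (Nat.cast_le.2 hin)
  have hratio₂ : (n / i : ℝ) ≤ 2 := (div_le_iff₀ hi₀).2 (by exact_mod_cast hni)
  obtain ⟨v, hv, hw⟩ := exists_mem_mul_mem_of_lt_volume (measurableSet_comparableRatios b N)
    (fun v hv => hv.1) hN hratio₁ hratio₂
  -- `b i` and `b n` are both comparable with `b ⌊v n⌋ = b ⌊(n / i) v i⌋`.
  have hsame : n / i * v * i = v * n := by field_simp
  have hi := (hw.2 i (by omega)).2
  have hn := (hv.2 n (by omega)).1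
  rw [hsame] at hi
  calc b i ≤ N * b ⌊v * n⌋₊ := hi
    _ ≤ N * (N * b n) := by gcongr
    _ = N * N * b n := by ring

lemma RegularlyVarying.eventually_half_le (hβ : 0 < β) (hb : ∀ n, 1 ≤ n → 0 < b n)
    (h : RegularlyVarying b β) : ∀ᶠ n : ℕ in atTop, b (n / 2) ≤ b n := by
  have hlt : (2⁻¹ : ℝ) ^ β < 1 := Real.rpow_lt_one (by norm_num) (by norm_num) hβ
  filter_upwards [(h 2⁻¹ (by norm_num)).eventually_lt_const hlt, eventually_ge_atTop 1] with n hn h₁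
  have hfloor : ⌊(2⁻¹ : ℝ) * n⌋₊ = n / 2 := by
    rw [inv_mul_eq_div, Nat.floor_div_ofNat, Nat.floor_natCast]
  rw [hfloor] at hn
  exact ((div_lt_one (hb n h₁)).1 hn).le

lemma RegularlyVarying.exists_le_mul_of_ge (hβ : 0 < β) (hb : ∀ n, 1 ≤ n → 0 < b n)
    (h : RegularlyVarying b β) :
    ∃ C : ℝ, ∃ N : ℕ, 0 < C ∧ ∀ n i : ℕ, N ≤ i → i ≤ n → b i ≤ C * b n := by
  obtain ⟨C, N₁, hC, hlocal⟩ := h.exists_le_mul_of_le_two_mul hb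
  obtain ⟨N₂, hhalf⟩ := eventually_atTop.1 (h.eventually_half_le hβ hb)
  refine ⟨C, max (max N₁ N₂) 1, hC, fun n => ?_⟩
  induction n using Nat.strong_induction_on with
  | _ n ih =>
    intro i hNi hin
    by_cases hni : n ≤ 2 * i
    · exact hlocal n i (by omega) hin hni
    · exact (ih (n / 2) (by omega) i hNi (by omega)).trans
        (mul_le_mul_of_nonneg_left (hhalf n (by omega)) hC.le)

lemma exists_le_mul_max (hb : ∀ n, 1 ≤ n → 0 < b n) {N : ℕ} (hN : 1 ≤ N) :
    ∃ K : ℝ, 0 < K ∧ ∀ i, 1 ≤ i → b i ≤ K * b (max i N) ∧ b (max i N) ≤ K * b i := by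
  set K : ℝ := ∑ i ∈ Finset.Icc 1 N, (b i / b N + b N / b i)
  have hterm : ∀ i ∈ Finset.Icc 1 N, 0 < b i / b N ∧ 0 < b N / b i := fun i hi =>
    have hbi := hb i (Finset.mem_Icc.1 hi).1
    ⟨div_pos hbi (hb N hN), div_pos (hb N hN) hbi⟩
  have hle : ∀ i ∈ Finset.Icc 1 N, b i / b N + b N / b i ≤ K := fun i hi =>
    Finset.single_le_sum (f := fun i => b i / b N + b N / b i)
      (fun j hj => (add_pos (hterm j hj).1 (hterm j hj).2).le) hi
  have hK : 1 ≤ K := by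
    have hKN := hle N (Finset.mem_Icc.2 ⟨hN, le_rfl⟩)
    rw [div_self (hb N hN).ne'] at hKN
    linarith
  refine ⟨K, one_pos.trans_le hK, fun i hi => ?_⟩
  have hbi := hb i hi
  rcases le_total N i with hNi | hiN
  · rw [max_eq_left hNi]
    exact ⟨le_mul_of_one_le_left hbi.le hK, le_mul_of_one_le_left hbi.le hK⟩
  · have hmem : i ∈ Finset.Icc 1 N := Finset.mem_Icc.2 ⟨hi, hiN⟩
    have hKi := hle i hmem
    obtain ⟨h₁, h₂⟩ := hterm i hmem
    rw [max_eq_right hiN, ← div_le_iff₀ (hb N hN), ← div_le_iff₀ hbi]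
    constructor <;> linarith

lemma RegularlyVarying.exists_le_mul (hβ : 0 < β) (hb : ∀ n, 1 ≤ n → 0 < b n)
    (h : RegularlyVarying b β) :
    ∃ C, 0 < C ∧ ∀ n i : ℕ, 1 ≤ i → i ≤ n → b i ≤ C * b n := by
  obtain ⟨C, N, hC, hlarge⟩ := h.exists_le_mul_of_ge hβ hb
  obtain ⟨K, hK, hmax⟩ := exists_le_mul_max hb (N := max N 1) (le_max_right N 1)
  refine ⟨K * (C * K), by positivity, fun n i hi hin => ?_⟩
  calc b i ≤ K * b (max i (max N 1)) := (hmax i hi).1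
    _ ≤ K * (C * b (max n (max N 1))) := by
        gcongr
        exact hlarge _ _ (by omega) (by omega)
    _ ≤ K * (C * (K * b n)) := by
        gcongr
        exact (hmax n (hi.trans hin)).2
    _ = K * (C * K) * b n := by ring

lemma RegularlyVarying.potter_bound {ρ : ℝ} (hρ : ρ < β) (hb : ∀ n, 1 ≤ n → 0 < b n)
    (h : RegularlyVarying b β) :
    ∃ C, 0 < C ∧ ∀ n i : ℕ, 1 ≤ i → i ≤ n → b i / b n ≤ C * ((i : ℝ) / n) ^ ρ := by
  obtain ⟨C, hC, hle⟩ := (h.mul_rpow (-ρ)).exists_le_mul (by linarith) (mul_rpow_pos hb _)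
  refine ⟨C, hC, fun n i hi hin => ?_⟩
  have hi₀ : (0 : ℝ) < i := Nat.cast_pos.2 hi
  have hn₀ : (0 : ℝ) < n := Nat.cast_pos.2 (hi.trans hin)
  have hin' := hle n i hi hin
  simp only [Real.rpow_neg (Nat.cast_nonneg _), ← div_eq_mul_inv] at hin'
  rw [div_le_iff₀ (by positivity)] at hin'
  rw [Real.div_rpow hi₀.le hn₀.le, div_le_iff₀ (hb n (hi.trans hin))]
  exact hin'.trans_eq (by ring)

end Potter

section RiemannSums

lemma ae_eq_apply_floor_add_one (x : ℕ → ℝ) (k : ℕ) :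
    ∀ᵐ v : ℝ, v ∈ Set.uIoc (k : ℝ) (k + 1 : ℕ) → x (k + 1) = x (⌊v⌋₊ + 1) := by
  filter_upwards [volume.ae_ne ((k + 1 : ℕ) : ℝ)] with v hne hv
  rw [Set.uIoc_of_le (Nat.cast_le.2 k.le_succ)] at hv
  have hfloor : ⌊v⌋₊ = k :=
    (Nat.floor_eq_iff (k.cast_nonneg.trans hv.1.le)).2
      ⟨hv.1.le, mod_cast hv.2.lt_of_ne hne⟩
  rw [hfloor]

lemma integral_apply_floor_add_one (x : ℕ → ℝ) (n : ℕ) :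
    ∫ v in (0 : ℝ)..n, x (⌊v⌋₊ + 1) = ∑ i ∈ Finset.Icc 1 n, x i := by
  have hint (k : ℕ) :
      IntervalIntegrable (fun v : ℝ => x (⌊v⌋₊ + 1)) volume k (k + 1 : ℕ) :=
    (intervalIntegrable_const (c := x (k + 1))).congr_ae
      ((ae_restrict_iff' measurableSet_uIoc).2 (ae_eq_apply_floor_add_one x k))
  have hpiece (k : ℕ) : ∫ v in (k : ℝ)..(k + 1 : ℕ), x (⌊v⌋₊ + 1) = x (k + 1) := by
    rw [← intervalIntegral.integral_congr_ae (ae_eq_apply_floor_add_one x k)]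
    simp
  rw [← Nat.cast_zero, ← intervalIntegral.sum_integral_adjacent_intervals fun k _ => hint k,
    Finset.sum_congr rfl fun k _ => hpiece k, Finset.range_eq_Ico, Finset.sum_Ico_add' x 0 n 1]
  rfl

lemma sum_div_eq_integral (x : ℕ → ℝ) {n : ℕ} (hn : n ≠ 0) :
    (∑ i ∈ Finset.Icc 1 n, x i) / n = ∫ u in (0 : ℝ)..1, x (⌊u * n⌋₊ + 1) := by
  rw [intervalIntegral.integral_comp_mul_right (fun v : ℝ => x (⌊v⌋₊ + 1))
    (Nat.cast_ne_zero.2 hn), zero_mul, one_mul, integral_apply_floor_add_one, smul_eq_mul,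
    inv_mul_eq_div]

lemma tendsto_sum_div_of_le_rpow {x : ℕ → ℕ → ℝ} {L : ℝ → ℝ} {C ρ : ℝ} (hρ : -1 < ρ)
    (hρ₀ : ρ ≤ 0) (hbound : ∀ n i : ℕ, 1 ≤ i → i ≤ n → |x n i| ≤ C * ((i : ℝ) / n) ^ ρ)
    (hlim : ∀ u : ℝ, 0 < u → u < 1 →
      Tendsto (fun n : ℕ => x n (⌊u * n⌋₊ + 1)) atTop (𝓝 (L u))) :
    Tendsto (fun n : ℕ => (∑ i ∈ Finset.Icc 1 n, x n i) / n) atTop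
      (𝓝 (∫ u in (0 : ℝ)..1, L u)) := by
  have hC : 0 ≤ C := by simpa using (abs_nonneg _).trans (hbound 1 1 le_rfl le_rfl)
  have hlt_one : ∀ᵐ u : ℝ, u ∈ Set.uIoc 0 1 → 0 < u ∧ u < 1 := by
    filter_upwards [volume.ae_ne (1 : ℝ)] with u hne hu
    rw [Set.uIoc_of_le zero_le_one] at hu
    exact ⟨hu.1, hu.2.lt_of_ne hne⟩
  have hdominated : ∀ n : ℕ, 1 ≤ n → ∀ u : ℝ, 0 < u → u < 1 →
      |x n (⌊u * n⌋₊ + 1)| ≤ C * u ^ ρ := by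
    intro n hn u hu₀ hu₁
    have hn₀ : (0 : ℝ) < n := Nat.cast_pos.2 hn
    have hfloor : ⌊u * n⌋₊ < n := (Nat.floor_lt (by positivity)).2 (by nlinarith)
    refine (hbound n _ (Nat.le_add_left 1 _) hfloor).trans ?_
    refine mul_le_mul_of_nonneg_left (Real.rpow_le_rpow_of_nonpos hu₀ ?_ hρ₀) hC
    rw [le_div_iff₀ hn₀, Nat.cast_add_one]
    exact (Nat.lt_floor_add_one _).le
  have hintegral : Tendsto (fun n : ℕ => ∫ u in (0 : ℝ)..1, x n (⌊u * n⌋₊ + 1)) atTop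
      (𝓝 (∫ u in (0 : ℝ)..1, L u)) := by
    refine intervalIntegral.tendsto_integral_filter_of_dominated_convergence
      (fun u => C * u ^ ρ) (.of_forall fun n => ?_) ?_
      ((intervalIntegral.intervalIntegrable_rpow' hρ).const_mul C) ?_
    · exact (measurable_apply_floor_mul (fun k => x n (k + 1)) n).aestronglyMeasurable
    · filter_upwards [eventually_ge_atTop 1] with n hn
      filter_upwards [hlt_one] with u hu hmem
      exact hdominated n hn u (hu hmem).1 (hu hmem).2
    · filter_upwards [hlt_one] with u hu hmem
      exact hlim u (hu hmem).1 (hu hmem).2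
  refine hintegral.congr' ?_
  filter_upwards [eventually_ne_atTop 0] with n hn
  exact (sum_div_eq_integral (x n) hn).symm

end RiemannSums

section Karamata

variable {a b : ℕ → ℝ} {α β : ℝ}

lemma RegularlyVarying.tendsto_sum_div (hβ : -1 < β) (hb : ∀ n, 1 ≤ n → 0 < b n)
    (h : RegularlyVarying b β) :
    Tendsto (fun n : ℕ => (∑ i ∈ Finset.Icc 1 n, b i) / (n * b n)) atTop (𝓝 (β + 1)⁻¹) := by
  set ρ : ℝ := min ((β - 1) / 2) 0
  have hρ : -1 < ρ := lt_min (by linarith) (by norm_num)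
  obtain ⟨C, -, hle⟩ := h.potter_bound (ρ := ρ) ((min_le_left _ _).trans_lt (by linarith)) hb
  have hlim := tendsto_sum_div_of_le_rpow (x := fun n i => b i / b n) hρ (min_le_right _ _)
    (fun n i hi hin => by
      rw [abs_of_pos (div_pos (hb i hi) (hb n (hi.trans hin)))]
      exact hle n i hi hin)
    fun u hu _ => h.tendsto_floor_succ hb hu
  rw [integral_rpow (Or.inl hβ), Real.one_rpow, Real.zero_rpow (by linarith), sub_zero,
    one_div] at hlim
  refine hlim.congr fun n => ?_
  rw [← Finset.sum_div, div_div, mul_comm]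

lemma weightedSum_eq_sum_range (a : ℕ → ℝ) (n : ℕ) :
    weightedSum a n = ∑ i ∈ Finset.range (n + 1), (i : ℝ)⁻¹ * a i := by
  rw [weightedSum, Finset.range_eq_Ico, Finset.sum_eq_sum_Ico_succ_bot n.succ_pos, Nat.cast_zero,
    inv_zero, zero_mul, zero_add]
  rfl

lemma weightedSum_mono (ha : ∀ n, 1 ≤ n → 0 < a n) : Monotone (weightedSum a) := fun m n hmn =>
  Finset.sum_le_sum_of_subset_of_nonneg (Finset.Icc_subset_Icc_right hmn) fun i hi _ =>
    mul_nonneg (by positivity) (ha i (Finset.mem_Icc.1 hi).1).le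

lemma le_weightedSum (ha : ∀ n, 1 ≤ n → 0 < a n) {n : ℕ} (hn : 1 ≤ n) :
    a 1 ≤ weightedSum a n := by
  simpa [weightedSum] using weightedSum_mono ha hn

lemma weightedSum_pos (ha : ∀ n, 1 ≤ n → 0 < a n) {n : ℕ} (hn : 1 ≤ n) : 0 < weightedSum a n :=
  (ha 1 le_rfl).trans_le (le_weightedSum ha hn)

lemma RegularlyVarying.tendsto_div_weightedSum_of_pos (hα : 0 < α) (ha : ∀ n, 1 ≤ n → 0 < a n)
    (h : RegularlyVarying a α) : Tendsto (fun n => a n / weightedSum a n) atTop (𝓝 α) := by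
  have hlim := ((h.mul_rpow (-1)).tendsto_sum_div (by linarith) (mul_rpow_pos ha _)).inv₀
    (by simpa using hα.ne')
  rw [inv_inv, neg_add_cancel_right] at hlim
  refine hlim.congr' ?_
  filter_upwards [eventually_ne_atTop 0] with n hn
  simp only [Real.rpow_neg_one, inv_div, weightedSum, mul_comm (a _)]
  rw [mul_inv_cancel_left₀ (Nat.cast_ne_zero.2 hn)]

lemma div_weightedSum_le_mul_rpow (ha : ∀ n, 1 ≤ n → 0 < a n) {ε : ℝ} (hε : 0 ≤ ε) {n : ℕ}
    (hn : 1 ≤ n) :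
    a n / weightedSum a n ≤ a n * (n : ℝ) ^ ε / weightedSum (fun i => a i * (i : ℝ) ^ ε) n := by
  rw [div_le_div_iff₀ (weightedSum_pos ha hn) (weightedSum_pos (mul_rpow_pos ha ε) hn), mul_assoc]
  refine mul_le_mul_of_nonneg_left ?_ (ha n hn).le
  rw [weightedSum, weightedSum, Finset.mul_sum]
  refine Finset.sum_le_sum fun i hi => ?_
  obtain ⟨hi₁, hin⟩ := Finset.mem_Icc.1 hi
  have hai := ha i hi₁
  calc (i : ℝ)⁻¹ * (a i * (i : ℝ) ^ ε) = (i : ℝ) ^ ε * ((i : ℝ)⁻¹ * a i) := by ring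
    _ ≤ (n : ℝ) ^ ε * ((i : ℝ)⁻¹ * a i) := by gcongr

lemma RegularlyVarying.tendsto_div_weightedSum (hα : 0 ≤ α) (ha : ∀ n, 1 ≤ n → 0 < a n)
    (h : RegularlyVarying a α) : Tendsto (fun n => a n / weightedSum a n) atTop (𝓝 α) := by
  rcases hα.lt_or_eq with hpos | rfl
  · exact h.tendsto_div_weightedSum_of_pos hpos ha
  -- Multiplying `a` by `n ^ ε` increases the ratio and reduces to the positive index `ε`.
  refine tendsto_order.2 ⟨fun c hc => ?_, fun ε hε => ?_⟩
  · filter_upwards [eventually_ge_atTop 1] with n hn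
    exact hc.trans (div_pos (ha n hn) (weightedSum_pos ha hn))
  · have hlim := (h.mul_rpow (ε / 2)).tendsto_div_weightedSum_of_pos (by linarith)
      (mul_rpow_pos ha _)
    filter_upwards [eventually_ge_atTop 1, hlim.eventually_lt_const (by linarith : 0 + ε / 2 < ε)]
      with n hn hlt
    exact (div_weightedSum_le_mul_rpow ha (by linarith) hn).trans_lt hlt

end Karamata

section LastSegment

/-- The total length of `T_n`. -/
def totalLength (a : ℕ → ℝ) (n : ℕ) : ℝ := ∑ i ∈ Finset.Icc 1 n, a i

/-- The probability that a uniform point of `T_n` belongs to the last segment. -/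
noncomputable def lastProb (a : ℕ → ℝ) (n : ℕ) : ℝ := a n / totalLength a n

variable {a : ℕ → ℝ} {α : ℝ}

lemma totalLength_succ (a : ℕ → ℝ) (n : ℕ) :
    totalLength a (n + 1) = totalLength a n + a (n + 1) :=
  Finset.sum_Icc_succ_top (by omega) _

lemma totalLength_nonneg (ha : ∀ n, 1 ≤ n → 0 < a n) (n : ℕ) : 0 ≤ totalLength a n :=
  Finset.sum_nonneg fun i hi => (ha i (Finset.mem_Icc.1 hi).1).le

lemma le_totalLength (ha : ∀ n, 1 ≤ n → 0 < a n) {n : ℕ} (hn : 1 ≤ n) : a n ≤ totalLength a n :=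
  Finset.single_le_sum (f := a) (fun i hi => (ha i (Finset.mem_Icc.1 hi).1).le)
    (Finset.mem_Icc.2 ⟨hn, le_rfl⟩)

lemma totalLength_pos (ha : ∀ n, 1 ≤ n → 0 < a n) {n : ℕ} (hn : 1 ≤ n) : 0 < totalLength a n :=
  (ha n hn).trans_le (le_totalLength ha hn)

lemma lastProb_zero (a : ℕ → ℝ) : lastProb a 0 = 0 := by simp [lastProb, totalLength]

lemma lastProb_one (ha : ∀ n, 1 ≤ n → 0 < a n) : lastProb a 1 = 1 := by
  simp [lastProb, totalLength, (ha 1 le_rfl).ne']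

lemma lastProb_mem_Icc (ha : ∀ n, 1 ≤ n → 0 < a n) (n : ℕ) : lastProb a n ∈ Set.Icc 0 1 := by
  rcases n.eq_zero_or_pos with rfl | hn
  · simp [lastProb_zero]
  · exact ⟨div_nonneg (ha n hn).le (totalLength_nonneg ha n),
      div_le_one_of_le₀ (le_totalLength ha hn) (totalLength_nonneg ha n)⟩

lemma RegularlyVarying.tendsto_mul_lastProb (hα : -1 < α) (ha : ∀ n, 1 ≤ n → 0 < a n)
    (h : RegularlyVarying a α) :
    Tendsto (fun n : ℕ => n * lastProb a n) atTop (𝓝 (α + 1)) := by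
  have hlim := (h.tendsto_sum_div hα ha).inv₀ (inv_ne_zero (by linarith))
  rw [inv_inv] at hlim
  refine hlim.congr fun n => ?_
  rw [inv_div, mul_div_assoc, lastProb, totalLength]

lemma RegularlyVarying.exists_lastProb_le (hα : -1 < α) (ha : ∀ n, 1 ≤ n → 0 < a n)
    (h : RegularlyVarying a α) : ∃ C, 0 ≤ C ∧ ∀ n, lastProb a n ≤ C * (n : ℝ)⁻¹ := by
  obtain ⟨C, hC⟩ := (h.tendsto_mul_lastProb hα ha).bddAbove_range
  have hle : ∀ n : ℕ, n * lastProb a n ≤ C := fun n => hC ⟨n, rfl⟩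
  refine ⟨C, by simpa using hle 0, fun n => ?_⟩
  rcases n.eq_zero_or_pos with rfl | hn
  · simp [lastProb_zero]
  · rw [← div_eq_mul_inv, le_div_iff₀ (Nat.cast_pos.2 hn), mul_comm]
    exact hle n

end LastSegment

section StepMGF

/-- The moment generating function of the uniform law on `[0, 1]`. -/
noncomputable def unifMGF (x : ℝ) : ℝ := ∫ s in (0 : ℝ)..1, Real.exp (x * s)

/-- The moment generating function of the product of two independent variables, a Bernoulli
variable of parameter `p` and a uniform variable on `[0, 1]`. -/
noncomputable def stepMGF (p x : ℝ) : ℝ := 1 + p * (unifMGF x - 1)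

/-- The moment generating function of the height of a uniform point of `T_n`: at each `i ≤ n`, the
`i`-th segment contributes with probability `lastProb a i`, and then by an independent uniform
portion of its length. -/
noncomputable def heightMGF (a : ℕ → ℝ) (n : ℕ) (t : ℝ) : ℝ :=
  ∏ i ∈ Finset.Icc 1 n, stepMGF (lastProb a i) (t * a i)

lemma mul_unifMGF (x : ℝ) : x * unifMGF x = Real.exp x - 1 := by
  simp [unifMGF]

lemma integral_exp_mul (t c : ℝ) :
    ∫ s in (0 : ℝ)..c, Real.exp (t * s) = c * unifMGF (t * c) := by
  have h := intervalIntegral.mul_integral_comp_mul_left (a := 0) (b := 1)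
    (f := fun s => Real.exp (t * s)) c
  rw [mul_zero, mul_one] at h
  simp only [unifMGF, ← h, mul_assoc]

lemma intervalIntegrable_exp_mul (x : ℝ) :
    IntervalIntegrable (fun s => Real.exp (x * s)) volume 0 1 :=
  Continuous.intervalIntegrable (by fun_prop) _ _

lemma unifMGF_zero : unifMGF 0 = 1 := by simp [unifMGF]

lemma continuous_unifMGF : Continuous unifMGF :=
  intervalIntegral.continuous_parametric_intervalIntegral_of_continuous' (by fun_prop) 0 1

lemma unifMGF_mono : Monotone unifMGF := fun x y hxy =>
  intervalIntegral.integral_mono_on zero_le_one (intervalIntegrable_exp_mul x)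
    (intervalIntegrable_exp_mul y) fun _ hs =>
      Real.exp_le_exp.2 (mul_le_mul_of_nonneg_right hxy hs.1)

lemma unifMGF_nonneg (x : ℝ) : 0 ≤ unifMGF x :=
  intervalIntegral.integral_nonneg zero_le_one fun _ _ => (Real.exp_pos _).le

lemma exp_neg_abs_le_unifMGF (x : ℝ) : Real.exp (-|x|) ≤ unifMGF x := by
  have hle := intervalIntegral.integral_mono_on zero_le_one intervalIntegrable_const
    (intervalIntegrable_exp_mul x) (f := fun _ => Real.exp (-|x|)) fun s hs =>
      Real.exp_le_exp.2 (neg_le_of_abs_le (by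
        rw [abs_mul, abs_of_nonneg hs.1]
        exact mul_le_of_le_one_right (abs_nonneg x) hs.2))
  simpa [unifMGF] using hle

lemma tendsto_unifMGF_atBot : Tendsto unifMGF atBot (𝓝 0) := by
  have hlim := (Real.tendsto_exp_atBot.sub_const 1).mul tendsto_inv_atBot_zero
  rw [mul_zero] at hlim
  refine hlim.congr' ?_
  filter_upwards [eventually_ne_atBot 0] with x hx
  rw [← mul_unifMGF, mul_comm, inv_mul_cancel_left₀ hx]

lemma abs_exp_sub_sum_le (y : ℝ) (n : ℕ) :
    |Real.exp y - ∑ m ∈ Finset.range n, y ^ m / m.factorial| ≤ |y| ^ n * Real.exp |y| := by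
  have h := Complex.norm_exp_sub_sum_le_norm_mul_exp (y : ℂ) n
  rw [Complex.norm_real, Real.norm_eq_abs] at h
  rwa [← Real.norm_eq_abs, ← Complex.norm_real, Complex.ofReal_sub, Complex.ofReal_exp,
    Complex.ofReal_sum, Finset.sum_congr rfl fun m _ => by push_cast; rfl]

lemma abs_unifMGF_sub_sum_le (x : ℝ) (n : ℕ) :
    |unifMGF x - ∑ m ∈ Finset.range n, x ^ m / (m + 1).factorial| ≤ |x| ^ n * Real.exp |x| := by
  have hsum : ∫ s in (0 : ℝ)..1, ∑ m ∈ Finset.range n, (x * s) ^ m / m.factorial =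
      ∑ m ∈ Finset.range n, x ^ m / (m + 1).factorial := by
    rw [intervalIntegral.integral_finsetSum
      fun m _ => Continuous.intervalIntegrable (by fun_prop) _ _]
    refine Finset.sum_congr rfl fun m _ => ?_
    simp only [mul_pow, intervalIntegral.integral_div, intervalIntegral.integral_const_mul,
      integral_pow, Nat.factorial_succ]
    push_cast
    field_simp
    simp
  rw [← hsum, unifMGF, ← intervalIntegral.integral_sub (intervalIntegrable_exp_mul x)
    (Continuous.intervalIntegrable (by fun_prop) _ _), ← Real.norm_eq_abs]
  refine (intervalIntegral.norm_integral_le_of_norm_le_const (C := |x| ^ n * Real.exp |x|)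
    fun s hs => (abs_exp_sub_sum_le (x * s) n).trans ?_).trans_eq (by simp)
  rw [Set.uIoc_of_le zero_le_one] at hs
  have hxs : |x * s| ≤ |x| := by
    rw [abs_mul, abs_of_pos hs.1]
    exact mul_le_of_le_one_right (abs_nonneg x) hs.2
  gcongr

lemma abs_unifMGF_sub_one_le (x : ℝ) : |unifMGF x - 1| ≤ |x| * Real.exp |x| := by
  simpa using abs_unifMGF_sub_sum_le x 1

lemma abs_unifMGF_sub_one_sub_half_le (x : ℝ) :
    |unifMGF x - 1 - x / 2| ≤ x ^ 2 * Real.exp |x| := by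
  simpa [Finset.sum_range_succ, sub_sub] using abs_unifMGF_sub_sum_le x 2

variable {p : ℝ}

lemma continuous_stepMGF (p : ℝ) : Continuous (stepMGF p) :=
  continuous_const.add (continuous_const.mul (continuous_unifMGF.sub continuous_const))

lemma stepMGF_zero_left (x : ℝ) : stepMGF 0 x = 1 := by simp [stepMGF]

lemma stepMGF_one_left (x : ℝ) : stepMGF 1 x = unifMGF x := by simp [stepMGF]

lemma stepMGF_le_one (hp : 0 ≤ p) {x : ℝ} (hx : x ≤ 0) : stepMGF p x ≤ 1 :=
  add_le_of_nonpos_right (mul_nonpos_of_nonneg_of_nonpos hp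
    (sub_nonpos.2 ((unifMGF_mono hx).trans_eq unifMGF_zero)))

lemma exp_neg_abs_le_stepMGF (hp : p ∈ Set.Icc 0 1) (x : ℝ) :
    Real.exp (-|x|) ≤ stepMGF p x := by
  have hx := exp_neg_abs_le_unifMGF x
  have hx₁ : Real.exp (-|x|) ≤ 1 := Real.exp_le_one_iff.2 (neg_nonpos.2 (abs_nonneg x))
  rw [stepMGF]
  nlinarith [hp.1, hp.2]

lemma stepMGF_pos (hp : p ∈ Set.Icc 0 1) (x : ℝ) : 0 < stepMGF p x :=
  (Real.exp_pos _).trans_le (exp_neg_abs_le_stepMGF hp x)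

lemma inv_stepMGF_le (hp : p ∈ Set.Icc 0 1) (x : ℝ) : (stepMGF p x)⁻¹ ≤ Real.exp |x| := by
  rw [inv_le_comm₀ (stepMGF_pos hp x) (Real.exp_pos _), ← Real.exp_neg]
  exact exp_neg_abs_le_stepMGF hp x

lemma abs_stepMGF_sub_one_le (hp : 0 ≤ p) (x : ℝ) :
    |stepMGF p x - 1| ≤ p * |x| * Real.exp |x| := by
  rw [stepMGF, add_sub_cancel_left, abs_mul, abs_of_nonneg hp, mul_assoc]
  exact mul_le_mul_of_nonneg_left (abs_unifMGF_sub_one_le x) hp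

lemma abs_log_stepMGF_le (hp : p ∈ Set.Icc 0 1) (x : ℝ) :
    |Real.log (stepMGF p x)| ≤ p * |x| * Real.exp (2 * |x|) := by
  have hp₀ := hp.1
  have hpos := stepMGF_pos hp x
  have hsub := abs_stepMGF_sub_one_le hp₀ x
  have hexp : 1 ≤ Real.exp |x| := Real.one_le_exp (abs_nonneg x)
  rw [two_mul, Real.exp_add, ← mul_assoc, abs_le']
  constructor
  · calc Real.log (stepMGF p x) ≤ stepMGF p x - 1 := Real.log_le_sub_one_of_pos hpos
      _ ≤ p * |x| * Real.exp |x| := (le_abs_self _).trans hsub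
      _ ≤ _ := le_mul_of_one_le_right (by positivity) hexp
  · calc -Real.log (stepMGF p x) ≤ (stepMGF p x)⁻¹ - 1 := by
          linarith [Real.one_sub_inv_le_log_of_pos hpos]
      _ = (1 - stepMGF p x) * (stepMGF p x)⁻¹ := by field_simp
      _ ≤ |stepMGF p x - 1| * (stepMGF p x)⁻¹ := by
          rw [abs_sub_comm]
          gcongr
          exact le_abs_self _
      _ ≤ _ := by
          gcongr
          exact inv_stepMGF_le hp x

lemma abs_log_sub_sub_one_le {w : ℝ} (hw : 0 < w) :
    |Real.log w - (w - 1)| ≤ (w - 1) ^ 2 * w⁻¹ := by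
  have hupper := Real.log_le_sub_one_of_pos hw
  have hlower := Real.one_sub_inv_le_log_of_pos hw
  have hsq : (w - 1) ^ 2 * w⁻¹ = (w - 1) - (1 - w⁻¹) := by
    field_simp
  rw [abs_of_nonpos (by linarith), hsq]
  linarith

lemma abs_log_stepMGF_sub_le (hp : p ∈ Set.Icc 0 1) (x : ℝ) :
    |Real.log (stepMGF p x) - p * x / 2| ≤ 2 * p * x ^ 2 * Real.exp (3 * |x|) := by
  obtain ⟨hp₀, hp₁⟩ := hp
  have hexp : Real.exp (3 * |x|) = Real.exp |x| ^ 2 * Real.exp |x| := by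
    rw [← pow_succ, ← Real.exp_nat_mul]
    norm_num
  have hlog : |Real.log (stepMGF p x) - (stepMGF p x - 1)| ≤ p * x ^ 2 * Real.exp (3 * |x|) :=
    calc |Real.log (stepMGF p x) - (stepMGF p x - 1)|
        ≤ (stepMGF p x - 1) ^ 2 * (stepMGF p x)⁻¹ :=
          abs_log_sub_sub_one_le (stepMGF_pos ⟨hp₀, hp₁⟩ x)
      _ ≤ (p * |x| * Real.exp |x|) ^ 2 * Real.exp |x| := by
          rw [← sq_abs (stepMGF p x - 1)]
          gcongr
          · exact inv_nonneg.2 (stepMGF_pos ⟨hp₀, hp₁⟩ x).le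
          · exact abs_stepMGF_sub_one_le hp₀ x
          · exact inv_stepMGF_le ⟨hp₀, hp₁⟩ x
      _ = p * p * x ^ 2 * Real.exp (3 * |x|) := by
          rw [hexp, mul_pow, mul_pow, sq_abs]
          ring
      _ ≤ p * x ^ 2 * Real.exp (3 * |x|) := by
          gcongr
          exact mul_le_of_le_one_right hp₀ hp₁
  have hunif : |stepMGF p x - 1 - p * x / 2| ≤ p * x ^ 2 * Real.exp (3 * |x|) :=
    calc |stepMGF p x - 1 - p * x / 2| = p * |unifMGF x - 1 - x / 2| := by
          rw [← abs_of_nonneg hp₀, ← abs_mul, abs_of_nonneg hp₀, stepMGF]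
          ring_nf
      _ ≤ p * (x ^ 2 * Real.exp |x|) := by
          gcongr
          exact abs_unifMGF_sub_one_sub_half_le x
      _ ≤ p * (x ^ 2 * Real.exp (3 * |x|)) := by
          gcongr
          linarith [abs_nonneg x]
      _ = p * x ^ 2 * Real.exp (3 * |x|) := by ring
  linarith [abs_sub_le (Real.log (stepMGF p x)) (stepMGF p x - 1) (p * x / 2)]

end StepMGF

section HeightMGF

variable {a : ℕ → ℝ}

lemma heightMGF_succ (a : ℕ → ℝ) (n : ℕ) (t : ℝ) :
    heightMGF a (n + 1) t = heightMGF a n t * stepMGF (lastProb a (n + 1)) (t * a (n + 1)) :=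
  Finset.prod_Icc_succ_top (by omega) _

lemma heightMGF_eq_exp_sum_log (ha : ∀ n, 1 ≤ n → 0 < a n) (n : ℕ) (t : ℝ) :
    heightMGF a n t =
      Real.exp (∑ i ∈ Finset.Icc 1 n, Real.log (stepMGF (lastProb a i) (t * a i))) := by
  rw [Real.exp_sum]
  exact Finset.prod_congr rfl fun i _ => (Real.exp_log (stepMGF_pos (lastProb_mem_Icc ha i) _)).symm

lemma heightMGF_pos (ha : ∀ n, 1 ≤ n → 0 < a n) (n : ℕ) (t : ℝ) : 0 < heightMGF a n t :=
  Finset.prod_pos fun i _ => stepMGF_pos (lastProb_mem_Icc ha i) _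

lemma heightMGF_le_unifMGF (ha : ∀ n, 1 ≤ n → 0 < a n) {n : ℕ} (hn : 1 ≤ n) {t : ℝ}
    (ht : t ≤ 0) : heightMGF a n t ≤ unifMGF (t * a 1) := by
  have hmem : 1 ∈ Finset.Icc 1 n := Finset.mem_Icc.2 ⟨le_rfl, hn⟩
  rw [heightMGF, ← Finset.mul_prod_erase _ _ hmem, lastProb_one ha, stepMGF_one_left]
  refine mul_le_of_le_one_right (unifMGF_nonneg _) (Finset.prod_le_one ?_ ?_) <;> intro i hi
  · exact (stepMGF_pos (lastProb_mem_Icc ha i) _).le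
  · have hi₁ := (Finset.mem_Icc.1 (Finset.mem_of_mem_erase hi)).1
    exact stepMGF_le_one (lastProb_mem_Icc ha i).1
      (mul_nonpos_of_nonpos_of_nonneg ht (ha i hi₁).le)

end HeightMGF

section Tree

lemma treeDist_succ_root_of_le {n : ℕ} {z : Pt} (hz : z.1 ≤ n) (y : ℕ → Pt) :
    treeDist y (n + 1) z root = treeDist y n z root := by
  have hz' : z.1 ≠ n + 1 := by omega
  cases n <;> simp [treeDist, root, hz']

lemma treeDist_succ_last_root (n : ℕ) {s : ℝ} (hs : 0 ≤ s) (y : ℕ → Pt) :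
    treeDist y (n + 1) (n + 1, s) root = s + treeDist y n (y n) root := by
  cases n <;> simp [treeDist, root, abs_of_nonneg hs]

lemma treeDist_root_congr {y y' : ℕ → Pt} {n : ℕ} (h : ∀ i, 1 ≤ i → i < n → y i = y' i)
    (p : Pt) : treeDist y n p root = treeDist y' n p root := by
  induction n generalizing p with
  | zero => rfl
  | succ n ih =>
    have ih' := ih fun i hi hin => h i hi (by omega)
    rcases n.eq_zero_or_pos with rfl | hn
    · simp [treeDist, root]
    · have hroot : root.1 ≠ n + 1 := by simp only [root]; omega
      simp only [treeDist, hroot, if_false, h n hn n.lt_succ_self, ih']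

lemma measurable_treeDist (n : ℕ) :
    Measurable fun x : (ℕ → Pt) × Pt × Pt => treeDist x.1 n x.2.1 x.2.2 := by
  induction n with
  | zero => exact measurable_const
  | succ n ih =>
    have hset {f : (ℕ → Pt) × Pt × Pt → ℕ} (hf : Measurable f) : MeasurableSet {x | f x = n + 1} :=
      hf (measurableSet_singleton _)
    have hcomp {f g : (ℕ → Pt) × Pt × Pt → Pt} (hf : Measurable f) (hg : Measurable g) :
        Measurable fun x => treeDist x.1 n (f x) (g x) :=
      ih.comp (measurable_fst.prodMk (hf.prodMk hg))
    simp only [treeDist]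
    refine Measurable.ite (hset (by fun_prop))
      (Measurable.ite (hset (by fun_prop)) (Measurable.abs (by fun_prop)) ?_)
      (Measurable.ite (hset (by fun_prop)) ?_ ih)
    · exact Measurable.add (by fun_prop) (hcomp (by fun_prop) (by fun_prop))
    · exact Measurable.add (hcomp (by fun_prop) (by fun_prop)) (by fun_prop)

/-- The gluing points `y 1, …, y (n - 1)` of `T_n`, completed to a sequence by an arbitrary value.
No measurability is assumed on the other points of the sequence, but they do not matter for the
distances in `T_n`. -/
def extendGluing (n : ℕ) (y : Finset.Ico 1 n → Pt) (i : ℕ) : Pt :=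
  if h : i ∈ Finset.Ico 1 n then y ⟨i, h⟩ else root

lemma measurable_extendGluing (n : ℕ) : Measurable (extendGluing n) := by
  refine measurable_pi_lambda _ fun i => ?_
  by_cases h : i ∈ Finset.Ico 1 n
  · simpa only [extendGluing, h, dif_pos] using measurable_pi_apply _
  · simpa only [extendGluing, h, dif_neg, not_false_eq_true] using measurable_const

lemma treeDist_extendGluing (n : ℕ) (y : ℕ → Pt) (p : Pt) :
    treeDist (extendGluing n fun i => y i) n p root = treeDist y n p root :=
  treeDist_root_congr (fun i hi hin => by simp [extendGluing, hi, hin]) p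

lemma measurable_treeDist_extendGluing (n : ℕ) :
    Measurable fun x : (Finset.Ico 1 n → Pt) × Pt =>
      treeDist (extendGluing n x.1) n x.2 root :=
  (measurable_treeDist n).comp (((measurable_extendGluing n).comp measurable_fst).prodMk
    (measurable_snd.prodMk measurable_const))

end Tree

section UniformLaw

variable {a : ℕ → ℝ}

lemma lintegral_lengthMeasure_succ (a : ℕ → ℝ) (n : ℕ) (f : Pt → ENNReal) :
    ∫⁻ z, f z ∂(lengthMeasure a (n + 1)) =
      ∫⁻ z, f z ∂(lengthMeasure a n) + ∫⁻ s in Set.Icc 0 (a (n + 1)), f (n + 1, s) := by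
  rw [lengthMeasure, Finset.sum_Icc_succ_top (by omega), lintegral_add_measure,
    (measurableEmbedding_prodMk_left (n + 1)).lintegral_map]
  rfl

lemma lengthMeasure_univ (ha : ∀ n, 1 ≤ n → 0 < a n) (n : ℕ) :
    lengthMeasure a n Set.univ = ENNReal.ofReal (totalLength a n) := by
  rw [totalLength, ENNReal.ofReal_sum_of_nonneg fun i hi => (ha i (Finset.mem_Icc.1 hi).1).le,
    lengthMeasure, Measure.finsetSum_apply]
  refine Finset.sum_congr rfl fun i _ => ?_
  rw [Measure.map_apply (by fun_prop) MeasurableSet.univ]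
  simp

lemma ae_lengthMeasure_fst_le (a : ℕ → ℝ) (n : ℕ) : ∀ᵐ z ∂(lengthMeasure a n), z.1 ≤ n := by
  rw [ae_iff, lengthMeasure, Measure.finsetSum_apply]
  refine Finset.sum_eq_zero fun i hi => ?_
  have hempty : (fun t : ℝ => ((i, t) : Pt)) ⁻¹' {z | ¬ z.1 ≤ n} = ∅ :=
    Set.eq_empty_of_forall_notMem fun _ hni => hni (Finset.mem_Icc.1 hi).2
  rw [(measurableEmbedding_prodMk_left i).map_apply, hempty, measure_empty]

lemma lintegral_uniformLaw_of_lengthMeasure (ha : ∀ n, 1 ≤ n → 0 < a n) {n : ℕ} (hn : 1 ≤ n)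
    {f : Pt → ENNReal} {c : ℝ}
    (hf : ∫⁻ z, f z ∂(lengthMeasure a n) = ENNReal.ofReal (totalLength a n * c)) :
    ∫⁻ z, f z ∂(uniformLaw a n) = ENNReal.ofReal c := by
  rw [uniformLaw, lintegral_smul_measure, hf, lengthMeasure_univ ha, smul_eq_mul,
    ENNReal.ofReal_mul (totalLength_nonneg ha n), ← mul_assoc,
    ENNReal.inv_mul_cancel (by simpa using totalLength_pos ha hn) ENNReal.ofReal_ne_top, one_mul]

lemma isProbabilityMeasure_uniformLaw (ha : ∀ n, 1 ≤ n → 0 < a n) {n : ℕ} (hn : 1 ≤ n) :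
    IsProbabilityMeasure (uniformLaw a n) := by
  refine ⟨?_⟩
  rw [← lintegral_one, ← ENNReal.ofReal_one]
  refine lintegral_uniformLaw_of_lengthMeasure ha hn ?_
  rw [ENNReal.ofReal_one, lintegral_one, lengthMeasure_univ ha, mul_one]

end UniformLaw

section HeightLaw

variable {Ω : Type*} [MeasurableSpace Ω] {a : ℕ → ℝ} {P : Measure Ω} {X Y : ℕ → Ω → Pt} {n : ℕ}

lemma UniformOnTree.aemeasurable_height (hX : UniformOnTree a P Y n (X n)) :
    AEMeasurable (height Y X n) P := by
  have hpair := (HasCondDistrib.aemeasurable_fst hX).prodMk (HasCondDistrib.aemeasurable_snd hX)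
  refine ((measurable_treeDist_extendGluing n).comp_aemeasurable hpair).congr ?_
  exact ae_of_all _ fun ω => treeDist_extendGluing n (fun i => Y i ω) (X n ω)

lemma UniformOnTree.lintegral_height [IsProbabilityMeasure P] (ha : ∀ n, 1 ≤ n → 0 < a n)
    (hn : 1 ≤ n) (hX : UniformOnTree a P Y n (X n)) {F : ℝ → ENNReal} (hF : Measurable F) :
    ∫⁻ ω, F (height Y X n ω) ∂P =
      ∫⁻ z, ∫⁻ ω, F (treeDist (fun i => Y i ω) n z root) ∂P ∂(uniformLaw a n) := by
  have := isProbabilityMeasure_uniformLaw ha hn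
  set Yn : Ω → Finset.Ico 1 n → Pt := fun ω i => Y i ω
  set G : (Finset.Ico 1 n → Pt) × Pt → ENNReal :=
    fun x => F (treeDist (extendGluing n x.1) n x.2 root)
  have hG : Measurable G := hF.comp (measurable_treeDist_extendGluing n)
  have hG_apply (ω : Ω) (z : Pt) : G (Yn ω, z) = F (treeDist (fun i => Y i ω) n z root) :=
    congrArg F (treeDist_extendGluing n (fun i => Y i ω) z)
  have hYn : AEMeasurable Yn P := HasCondDistrib.aemeasurable_fst hX
  have := Measure.isProbabilityMeasure_map hYn
  have hlaw : P.map (fun ω => (Yn ω, X n ω)) = (P.map Yn).prod (uniformLaw a n) := by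
    rw [HasLaw.map_eq hX, Measure.compProd_const]
  calc ∫⁻ ω, F (height Y X n ω) ∂P
      = ∫⁻ ω, G (Yn ω, X n ω) ∂P := lintegral_congr fun ω => (hG_apply ω (X n ω)).symm
    _ = ∫⁻ x, G x ∂((P.map Yn).prod (uniformLaw a n)) := by
        rw [← hlaw, lintegral_map' hG.aemeasurable (HasLaw.aemeasurable hX)]
    _ = ∫⁻ z, ∫⁻ y, G (y, z) ∂(P.map Yn) ∂(uniformLaw a n) :=
        lintegral_prod_symm _ hG.aemeasurable
    _ = ∫⁻ z, ∫⁻ ω, G (Yn ω, z) ∂P ∂(uniformLaw a n) := lintegral_congr fun z =>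
        lintegral_map' (hG.comp measurable_prodMk_right).aemeasurable hYn
    _ = _ := by simp only [hG_apply]

lemma lintegral_exp_mul_Icc {c : ℝ} (hc : 0 ≤ c) (t : ℝ) :
    ∫⁻ s in Set.Icc 0 c, ENNReal.ofReal (Real.exp (t * s)) =
      ENNReal.ofReal (c * unifMGF (t * c)) := by
  rw [← ofReal_integral_eq_lintegral_ofReal (Continuous.integrableOn_Icc (by fun_prop))
      (ae_of_all _ fun s => Real.exp_nonneg _),
    integral_Icc_eq_integral_Ioc, ← intervalIntegral.integral_of_le hc, integral_exp_mul]

lemma totalLength_succ_mul_stepMGF (ha : ∀ n, 1 ≤ n → 0 < a n) (n : ℕ) (x : ℝ) :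
    totalLength a (n + 1) * stepMGF (lastProb a (n + 1)) x =
      totalLength a n + a (n + 1) * unifMGF x := by
  have hpos := totalLength_pos ha (Nat.le_add_left 1 n)
  rw [stepMGF, lastProb, mul_add, ← mul_assoc, mul_div_cancel₀ _ hpos.ne', totalLength_succ]
  ring

lemma lintegral_exp_treeDist_succ (ha : ∀ n, 1 ≤ n → 0 < a n) (Y : ℕ → Ω → Pt) (n : ℕ) (t : ℝ) :
    ∫⁻ z, ∫⁻ ω, ENNReal.ofReal (Real.exp (t * treeDist (fun i => Y i ω) (n + 1) z root)) ∂P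
        ∂(lengthMeasure a (n + 1)) =
      ∫⁻ z, ∫⁻ ω, ENNReal.ofReal (Real.exp (t * treeDist (fun i => Y i ω) n z root)) ∂P
        ∂(lengthMeasure a n) +
      ENNReal.ofReal (a (n + 1) * unifMGF (t * a (n + 1))) *
        ∫⁻ ω, ENNReal.ofReal (Real.exp (t * height Y Y n ω)) ∂P := by
  rw [lintegral_lengthMeasure_succ, ← lintegral_exp_mul_Icc (ha _ (Nat.le_add_left 1 n)).le,
    ← lintegral_mul_const _ (by fun_prop)]
  congr 1
  · refine lintegral_congr_ae ?_
    filter_upwards [ae_lengthMeasure_fst_le a n] with z hz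
    simp only [treeDist_succ_root_of_le hz]
  · refine setLIntegral_congr_fun measurableSet_Icc fun s hs => ?_
    simp only [treeDist_succ_last_root n hs.1, mul_add, Real.exp_add,
      ENNReal.ofReal_mul (Real.exp_nonneg _)]
    exact lintegral_const_mul' _ _ ENNReal.ofReal_ne_top

lemma lintegral_exp_treeDist [IsProbabilityMeasure P] (ha : ∀ n, 1 ≤ n → 0 < a n)
    (hY : IsGluing a P Y) (n : ℕ) (t : ℝ) :
    ∫⁻ z, ∫⁻ ω, ENNReal.ofReal (Real.exp (t * treeDist (fun i => Y i ω) n z root)) ∂P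
        ∂(lengthMeasure a n) = ENNReal.ofReal (totalLength a n * heightMGF a n t) := by
  induction n with
  | zero => simp [lengthMeasure, totalLength]
  | succ n ih =>
    have hgluing : ∫⁻ ω, ENNReal.ofReal (Real.exp (t * height Y Y n ω)) ∂P =
        ENNReal.ofReal (heightMGF a n t) := by
      rcases n.eq_zero_or_pos with rfl | hn
      · simp [height, treeDist, heightMGF]
      · rw [(hY n hn).lintegral_height ha hn
          (F := fun x => ENNReal.ofReal (Real.exp (t * x))) (by fun_prop)]
        exact lintegral_uniformLaw_of_lengthMeasure ha hn ih
    have hpos := (heightMGF_pos ha n t).le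
    have hlast : 0 ≤ a (n + 1) * unifMGF (t * a (n + 1)) :=
      mul_nonneg (ha _ (Nat.le_add_left 1 n)).le (unifMGF_nonneg _)
    rw [lintegral_exp_treeDist_succ ha, ih, hgluing, ← ENNReal.ofReal_mul hlast,
      ← ENNReal.ofReal_add (mul_nonneg (totalLength_nonneg ha n) hpos) (mul_nonneg hlast hpos),
      ← add_mul, ← totalLength_succ_mul_stepMGF ha, heightMGF_succ, mul_assoc,
      mul_comm (heightMGF a n t)]

lemma aemeasurable_height (hX : ∀ n, 1 ≤ n → UniformOnTree a P Y n (X n)) (n : ℕ) :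
    AEMeasurable (height Y X n) P := by
  rcases n.eq_zero_or_pos with rfl | hn
  · exact aemeasurable_const
  · exact (hX n hn).aemeasurable_height

variable [IsProbabilityMeasure P]

lemma lintegral_exp_height (ha : ∀ n, 1 ≤ n → 0 < a n) (hY : IsGluing a P Y)
    (hX : ∀ n, 1 ≤ n → UniformOnTree a P Y n (X n)) (n : ℕ) (t : ℝ) :
    ∫⁻ ω, ENNReal.ofReal (Real.exp (t * height Y X n ω)) ∂P =
      ENNReal.ofReal (heightMGF a n t) := by
  rcases n.eq_zero_or_pos with rfl | hn
  · simp [height, treeDist, heightMGF]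
  · rw [(hX n hn).lintegral_height ha hn
      (F := fun x => ENNReal.ofReal (Real.exp (t * x))) (by fun_prop)]
    exact lintegral_uniformLaw_of_lengthMeasure ha hn (lintegral_exp_treeDist ha hY n t)

lemma integrable_exp_height (ha : ∀ n, 1 ≤ n → 0 < a n) (hY : IsGluing a P Y)
    (hX : ∀ n, 1 ≤ n → UniformOnTree a P Y n (X n)) (n : ℕ) (t : ℝ) :
    Integrable (fun ω => Real.exp (t * height Y X n ω)) P := by
  refine ⟨(Real.measurable_exp.comp_aemeasurable
    ((aemeasurable_height hX n).const_mul t)).aestronglyMeasurable, ?_⟩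
  rw [hasFiniteIntegral_iff_ofReal (ae_of_all _ fun _ => Real.exp_nonneg _),
    lintegral_exp_height ha hY hX]
  exact ENNReal.ofReal_lt_top

lemma mgf_height (ha : ∀ n, 1 ≤ n → 0 < a n) (hY : IsGluing a P Y)
    (hX : ∀ n, 1 ≤ n → UniformOnTree a P Y n (X n)) (n : ℕ) (t : ℝ) :
    mgf (height Y X n) P t = heightMGF a n t := by
  rw [mgf, integral_eq_lintegral_of_nonneg_ae (ae_of_all _ fun _ => Real.exp_nonneg _)
    (integrable_exp_height ha hY hX n t).1, lintegral_exp_height ha hY hX,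
    ENNReal.toReal_ofReal (heightMGF_pos ha n t).le]

end HeightLaw

section Phi

variable {α : ℝ}

lemma norm_expKernel_le (x : ℝ) {u : ℝ} (hu : u ∈ Set.Ioc 0 1) :
    ‖(Real.exp (x * u) - 1) * ((1 - u) / u)‖ ≤ |x| * Real.exp |x| := by
  obtain ⟨hu₀, hu₁⟩ := hu
  have hexp : |Real.exp (x * u) - 1| ≤ |x * u| * Real.exp |x * u| := by
    simpa using abs_exp_sub_sum_le (x * u) 1
  have hratio : 0 ≤ (1 - u) / u := div_nonneg (by linarith) hu₀.le
  rw [abs_mul, abs_of_pos hu₀] at hexp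
  rw [norm_mul, Real.norm_eq_abs, Real.norm_of_nonneg hratio]
  calc |Real.exp (x * u) - 1| * ((1 - u) / u)
      ≤ |x| * u * Real.exp (|x| * u) * ((1 - u) / u) := by gcongr
    _ = |x| * Real.exp (|x| * u) * (1 - u) := by field_simp
    _ ≤ |x| * Real.exp (|x| * 1) * 1 := by
        gcongr
        linarith
    _ = |x| * Real.exp |x| := by simp only [mul_one]

lemma intervalIntegrable_expKernel (x : ℝ) :
    IntervalIntegrable (fun u : ℝ => (Real.exp (x * u) - 1) * ((1 - u) / u)) volume 0 1 := by
  rw [intervalIntegrable_iff, Set.uIoc_of_le zero_le_one]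
  refine IntegrableOn.of_bound (by simp) (Measurable.aestronglyMeasurable (by fun_prop))
    (|x| * Real.exp |x|) ?_
  filter_upwards [ae_restrict_mem measurableSet_Ioc] with u hu
  exact norm_expKernel_le x hu

lemma norm_exp_mul_one_sub_le {x u : ℝ} (hu : u ∈ Set.Ioc 0 1) :
    ‖Real.exp (x * u) * (1 - u)‖ ≤ Real.exp |x| := by
  obtain ⟨hu₀, hu₁⟩ := hu
  rw [norm_mul, Real.norm_of_nonneg (Real.exp_nonneg _), Real.norm_of_nonneg (by linarith)]
  have hxu : x * u ≤ |x| := by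
    nlinarith [le_abs_self x, abs_nonneg x]
  calc Real.exp (x * u) * (1 - u) ≤ Real.exp |x| * 1 := by
        gcongr
        linarith
    _ = Real.exp |x| := mul_one _

lemma hasDerivAt_phi (α x : ℝ) :
    HasDerivAt (phi α) ((α + 1) / α * ∫ u in (0 : ℝ)..1, Real.exp (x * u) * (1 - u)) x := by
  refine HasDerivAt.const_mul _
    (intervalIntegral.hasDerivAt_integral_of_dominated_loc_of_deriv_le
    (F' := fun y u => Real.exp (y * u) * (1 - u)) (bound := fun _ => Real.exp (|x| + 1))
    (Metric.ball_mem_nhds x one_pos)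
    (.of_forall fun y => Measurable.aestronglyMeasurable (by fun_prop))
    (intervalIntegrable_expKernel x) (Measurable.aestronglyMeasurable (by fun_prop))
    ?_ intervalIntegrable_const ?_).2
  all_goals
    refine ae_of_all _ fun u hu y hy => ?_
    rw [Set.uIoc_of_le zero_le_one] at hu
  · rw [Metric.mem_ball, Real.dist_eq] at hy
    exact (norm_exp_mul_one_sub_le hu).trans
      (Real.exp_le_exp.2 (by linarith [abs_sub_abs_le_abs_sub y x]))
  · have hu₀ : u ≠ 0 := hu.1.ne'
    have hexp : HasDerivAt (fun y : ℝ => Real.exp (y * u)) (Real.exp (y * u) * u) y := by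
      simpa using ((hasDerivAt_id y).mul_const u).exp
    exact ((hexp.sub_const 1).mul_const ((1 - u) / u)).congr_deriv (by field_simp)

lemma mul_integral_exp_mul_one_sub (x : ℝ) :
    x * ∫ u in (0 : ℝ)..1, Real.exp (x * u) * (1 - u) = unifMGF x - 1 := by
  have hderiv (u : ℝ) : HasDerivAt (fun u : ℝ => Real.exp (x * u) * (1 - u))
      (x * (Real.exp (x * u) * (1 - u)) - Real.exp (x * u)) u := by
    have hexp : HasDerivAt (fun u : ℝ => Real.exp (x * u)) (Real.exp (x * u) * x) u := by
      simpa using ((hasDerivAt_id u).const_mul x).exp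
    exact (hexp.mul ((hasDerivAt_id u).const_sub 1)).congr_deriv (by simp only [id]; ring)
  have hFTC := intervalIntegral.integral_eq_sub_of_hasDerivAt (a := 0) (b := 1)
    (fun u _ => hderiv u) (Continuous.intervalIntegrable (by fun_prop) _ _)
  rw [intervalIntegral.integral_sub (Continuous.intervalIntegrable (by fun_prop) _ _)
    (intervalIntegrable_exp_mul x), intervalIntegral.integral_const_mul, ← unifMGF] at hFTC
  simp only [mul_zero, Real.exp_zero, sub_self, sub_zero, mul_one] at hFTC
  linarith

lemma hasDerivAt_phi_mul_rpow (hα : α ≠ 0) (x : ℝ) {v : ℝ} (hv : 0 < v) :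
    HasDerivAt (fun v : ℝ => phi α (x * v ^ α))
      ((α + 1) * v⁻¹ * (unifMGF (x * v ^ α) - 1)) v := by
  have hrpow : HasDerivAt (fun v : ℝ => x * v ^ α) (x * (α * v ^ (α - 1))) v :=
    (Real.hasDerivAt_rpow_const (Or.inl hv.ne')).const_mul x
  refine ((hasDerivAt_phi α _).comp v hrpow).congr_deriv ?_
  rw [← mul_integral_exp_mul_one_sub, Real.rpow_sub_one hv.ne']
  field_simp

lemma intervalIntegrable_inv_mul_unifMGF_sub_one (hα : 0 < α) (x : ℝ) :
    IntervalIntegrable (fun v : ℝ => v⁻¹ * (unifMGF (x * v ^ α) - 1)) volume 0 1 := by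
  have hdom : IntervalIntegrable (fun v : ℝ => |x| * Real.exp |x| * v ^ (α - 1)) volume 0 1 :=
    (intervalIntegral.intervalIntegrable_rpow' (by linarith)).const_mul _
  refine hdom.mono_fun' ?_ ?_
  · exact (measurable_inv.mul ((continuous_unifMGF.measurable.comp
      ((measurable_id.pow_const α).const_mul x)).sub_const 1)).aestronglyMeasurable
  filter_upwards [ae_restrict_mem measurableSet_uIoc] with v hv
  rw [Set.uIoc_of_le zero_le_one] at hv
  have hv₀ := hv.1
  have hxv : |x * v ^ α| = |x| * v ^ α := by
    rw [abs_mul, abs_of_pos (Real.rpow_pos_of_pos hv₀ α)]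
  have hxv_le : |x * v ^ α| ≤ |x| := by
    rw [hxv]
    exact mul_le_of_le_one_right (abs_nonneg _) (Real.rpow_le_one hv₀.le hv.2 hα.le)
  rw [norm_mul, Real.norm_of_nonneg (inv_pos.2 hv₀).le, Real.norm_eq_abs]
  calc v⁻¹ * |unifMGF (x * v ^ α) - 1| ≤ v⁻¹ * (|x * v ^ α| * Real.exp |x * v ^ α|) := by
        gcongr
        exact abs_unifMGF_sub_one_le _
    _ ≤ v⁻¹ * (|x * v ^ α| * Real.exp |x|) := by gcongr
    _ = |x| * Real.exp |x| * v ^ (α - 1) := by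
        rw [hxv, Real.rpow_sub_one hv₀.ne']
        ring

lemma integral_unifMGF_sub_one_eq_phi (hα : 0 < α) (x : ℝ) :
    ∫ v in (0 : ℝ)..1, (α + 1) * v⁻¹ * (unifMGF (x * v ^ α) - 1) = phi α x := by
  have hcont : Continuous (phi α) :=
    continuous_iff_continuousAt.2 fun y => (hasDerivAt_phi α y).continuousAt
  have hint : IntervalIntegrable
      (fun v : ℝ => (α + 1) * v⁻¹ * (unifMGF (x * v ^ α) - 1)) volume 0 1 := by
    simpa only [mul_assoc] using
      (intervalIntegrable_inv_mul_unifMGF_sub_one hα x).const_mul (α + 1)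
  rw [intervalIntegral.integral_eq_sub_of_hasDerivAt_of_le zero_le_one
    (hcont.comp (continuous_const.mul (Real.continuous_rpow_const hα.le))).continuousOn
    (fun v hv => hasDerivAt_phi_mul_rpow hα.ne' x hv.1) hint]
  simp [phi, Real.zero_rpow hα.ne']

end Phi

section PositiveIndex

variable {a : ℕ → ℝ} {α : ℝ}

lemma RegularlyVarying.exists_abs_div_weightedSum_mul_le (hα : 0 ≤ α)
    (ha : ∀ n, 1 ≤ n → 0 < a n) (h : RegularlyVarying a α) {ρ : ℝ} (hρ : ρ < α) (t : ℝ) :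
    ∃ C, 0 ≤ C ∧ ∀ n i : ℕ, 1 ≤ i → i ≤ n →
      |t / weightedSum a n * a i| ≤ C * ((i : ℝ) / n) ^ ρ := by
  obtain ⟨C₁, hC₁, hpotter⟩ := h.potter_bound hρ ha
  obtain ⟨C₂, hC₂⟩ := (h.tendsto_div_weightedSum hα ha).bddAbove_range
  have hterm : ∀ n, a n / weightedSum a n ≤ C₂ := fun n => hC₂ ⟨n, rfl⟩
  have hC₂_nonneg : 0 ≤ C₂ :=
    (div_pos (ha 1 le_rfl) (weightedSum_pos ha le_rfl)).le.trans (hterm 1)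
  refine ⟨|t| * (C₁ * C₂), by positivity, fun n i hi hin => ?_⟩
  have hS := weightedSum_pos ha (hi.trans hin)
  have hai := ha i hi
  have han := ha n (hi.trans hin)
  rw [abs_mul, abs_div, abs_of_pos hS, abs_of_pos hai]
  calc |t| / weightedSum a n * a i = |t| * ((a i / a n) * (a n / weightedSum a n)) := by
        field_simp
    _ ≤ |t| * ((C₁ * ((i : ℝ) / n) ^ ρ) * C₂) := by
        gcongr
        · exact hpotter n i hi hin
        · exact hterm n
    _ = |t| * (C₁ * C₂) * ((i : ℝ) / n) ^ ρ := by ring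

lemma RegularlyVarying.exists_abs_mul_log_stepMGF_le (hα : 0 ≤ α) (ha : ∀ n, 1 ≤ n → 0 < a n)
    (h : RegularlyVarying a α) {ρ : ℝ} (hρ₀ : 0 ≤ ρ) (hρ : ρ < α) (t : ℝ) :
    ∃ C, ∀ n i : ℕ, 1 ≤ i → i ≤ n →
      |n * Real.log (stepMGF (lastProb a i) (t / weightedSum a n * a i))| ≤
        C * ((i : ℝ) / n) ^ (ρ - 1) := by
  obtain ⟨C₁, hC₁, hlast⟩ := h.exists_lastProb_le (by linarith) ha
  obtain ⟨C₂, hC₂, hratio⟩ := h.exists_abs_div_weightedSum_mul_le hα ha hρ t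
  refine ⟨C₁ * C₂ * Real.exp (2 * C₂), fun n i hi hin => ?_⟩
  have hn₀ : (0 : ℝ) < n := Nat.cast_pos.2 (hi.trans hin)
  have hle := hratio n i hi hin
  set x := t / weightedSum a n * a i
  have hx : |x| ≤ C₂ := hle.trans (mul_le_of_le_one_right hC₂
    (Real.rpow_le_one (by positivity) (div_le_one_of_le₀ (Nat.cast_le.2 hin) hn₀.le) hρ₀))
  rw [abs_mul, abs_of_pos hn₀, Real.rpow_sub_one (by positivity)]
  calc n * |Real.log (stepMGF (lastProb a i) x)|
      ≤ n * (lastProb a i * |x| * Real.exp (2 * |x|)) := by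
        gcongr
        exact abs_log_stepMGF_le (lastProb_mem_Icc ha i) x
    _ ≤ n * (C₁ * (i : ℝ)⁻¹ * (C₂ * ((i : ℝ) / n) ^ ρ) * Real.exp (2 * C₂)) := by
        gcongr
        exact hlast i
    _ = C₁ * C₂ * Real.exp (2 * C₂) * (((i : ℝ) / n) ^ ρ / ((i : ℝ) / n)) := by field_simp

lemma RegularlyVarying.tendsto_div_weightedSum_mul_floor (hα : 0 ≤ α)
    (ha : ∀ n, 1 ≤ n → 0 < a n) (h : RegularlyVarying a α) (t : ℝ) {u : ℝ} (hu : 0 < u) :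
    Tendsto (fun n : ℕ => t / weightedSum a n * a (⌊u * n⌋₊ + 1)) atTop
      (𝓝 (α * t * u ^ α)) := by
  have hlim := ((h.tendsto_floor_succ ha hu).mul (h.tendsto_div_weightedSum hα ha)).const_mul t
  rw [show t * (u ^ α * α) = α * t * u ^ α by ring] at hlim
  refine hlim.congr' ?_
  filter_upwards [eventually_ge_atTop 1] with n hn
  rw [div_mul_div_cancel₀ (ha n hn).ne']
  ring

lemma RegularlyVarying.tendsto_mul_log_stepMGF_floor (hα : 0 ≤ α)
    (ha : ∀ n, 1 ≤ n → 0 < a n) (h : RegularlyVarying a α) (t : ℝ) {u : ℝ} (hu : 0 < u) :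
    Tendsto (fun n : ℕ => n * Real.log (stepMGF (lastProb a (⌊u * n⌋₊ + 1))
      (t / weightedSum a n * a (⌊u * n⌋₊ + 1)))) atTop
      (𝓝 ((α + 1) * u⁻¹ * (unifMGF (α * t * u ^ α) - 1))) := by
  refine Real.tendsto_nat_mul_log_one_add_of_tendsto ?_
  have hfloor : Tendsto (fun n : ℕ => ⌊u * n⌋₊ + 1) atTop atTop :=
    (tendsto_add_atTop_nat 1).comp (tendsto_floor_mul_atTop hu)
  have hlast := (h.tendsto_mul_lastProb (by linarith) ha).comp hfloor
  have hunif := ((continuous_unifMGF.tendsto _).comp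
    (h.tendsto_div_weightedSum_mul_floor hα ha t hu)).sub_const 1
  refine ((hlast.mul ((tendsto_floor_mul_add_one_div hu.le).inv₀ hu.ne')).mul hunif).congr' ?_
  filter_upwards [eventually_ne_atTop 0] with n hn
  have hn' : (n : ℝ) ≠ 0 := Nat.cast_ne_zero.2 hn
  have hfloor_ne : ((⌊u * n⌋₊ + 1 : ℕ) : ℝ) ≠ 0 := Nat.cast_ne_zero.2 (Nat.succ_ne_zero _)
  simp only [Function.comp]
  field_simp

lemma RegularlyVarying.tendsto_heightMGF_of_pos (hα : 0 < α) (ha : ∀ n, 1 ≤ n → 0 < a n)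
    (h : RegularlyVarying a α) (t : ℝ) :
    Tendsto (fun n => heightMGF a n (t / weightedSum a n)) atTop
      (𝓝 (Real.exp (phi α (α * t)))) := by
  set ρ : ℝ := min (α / 2) 1
  have hρ₀ : 0 < ρ := lt_min (by linarith) one_pos
  have hρ : ρ < α := (min_le_left _ _).trans_lt (by linarith)
  obtain ⟨C, hC⟩ := h.exists_abs_mul_log_stepMGF_le hα.le ha hρ₀.le hρ t
  have hsum := tendsto_sum_div_of_le_rpow (by linarith : -1 < ρ - 1)
    (sub_nonpos.2 (min_le_right _ _)) hC
    fun u hu _ => h.tendsto_mul_log_stepMGF_floor hα.le ha t hu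
  rw [integral_unifMGF_sub_one_eq_phi hα] at hsum
  refine ((Real.continuous_exp.tendsto _).comp hsum).congr' ?_
  filter_upwards [eventually_ne_atTop 0] with n hn
  rw [heightMGF_eq_exp_sum_log ha, Function.comp, ← Finset.mul_sum,
    mul_div_cancel_left₀ _ (Nat.cast_ne_zero.2 hn)]

end PositiveIndex

section IndexZero

variable {a : ℕ → ℝ}

lemma tendsto_sum_mul_div_sum {w z : ℕ → ℝ} {l : ℝ} (hw : ∀ i, 0 ≤ w i)
    (hsum : Tendsto (fun n => ∑ i ∈ Finset.range n, w i) atTop atTop)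
    (hz : Tendsto z atTop (𝓝 l)) :
    Tendsto (fun n => (∑ i ∈ Finset.range n, w i * z i) / ∑ i ∈ Finset.range n, w i) atTop
      (𝓝 l) := by
  have hlittle : (fun i => w i * (z i - l)) =o[atTop] w := by
    have hz₀ : Tendsto (fun i => z i - l) atTop (𝓝 0) := by simpa using hz.sub_const l
    simpa using (Asymptotics.isBigO_refl w atTop).mul_isLittleO
      ((Asymptotics.isLittleO_one_iff ℝ).2 hz₀)
  have hlim := (hlittle.sum_range hw hsum).tendsto_div_nhds_zero.add_const l
  rw [zero_add] at hlim
  refine hlim.congr' ?_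
  filter_upwards [hsum.eventually_ne_atTop 0] with n hn
  simp only [mul_sub, Finset.sum_sub_distrib, ← Finset.sum_mul]
  field_simp
  ring

lemma inv_mul_nonneg (ha : ∀ n, 1 ≤ n → 0 < a n) (i : ℕ) : 0 ≤ (i : ℝ)⁻¹ * a i := by
  rcases i.eq_zero_or_pos with rfl | hi
  · simp
  · exact mul_nonneg (by positivity) (ha i hi).le

lemma tendsto_weightedSum_mul_div (ha : ∀ n, 1 ≤ n → 0 < a n)
    (hS : ¬ Summable fun i : ℕ => (i : ℝ)⁻¹ * a i) {z : ℕ → ℝ} {l : ℝ}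
    (hz : Tendsto z atTop (𝓝 l)) :
    Tendsto (fun n => weightedSum (fun i => a i * z i) n / weightedSum a n) atTop (𝓝 l) := by
  have hsum := (not_summable_iff_tendsto_nat_atTop_of_nonneg (inv_mul_nonneg ha)).1 hS
  simpa only [weightedSum_eq_sum_range, Function.comp_def, mul_assoc] using
    (tendsto_sum_mul_div_sum (inv_mul_nonneg ha) hsum hz).comp (tendsto_add_atTop_nat 1)

lemma weightedSum_mul_lastProb (a z : ℕ → ℝ) (n : ℕ) :
    weightedSum (fun i => a i * (i * lastProb a i * z i)) n =
      ∑ i ∈ Finset.Icc 1 n, lastProb a i * a i * z i := by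
  refine Finset.sum_congr rfl fun i hi => ?_
  have hi₀ : (i : ℝ) ≠ 0 := Nat.cast_ne_zero.2 (Nat.ne_of_gt (Finset.mem_Icc.1 hi).1)
  field_simp

lemma RegularlyVarying.tendsto_sum_lastProb_mul_div (ha : ∀ n, 1 ≤ n → 0 < a n)
    (h : RegularlyVarying a 0) (hS : ¬ Summable fun i : ℕ => (i : ℝ)⁻¹ * a i) {z : ℕ → ℝ} {l : ℝ}
    (hz : Tendsto z atTop (𝓝 l)) :
    Tendsto (fun n => (∑ i ∈ Finset.Icc 1 n, lastProb a i * a i * z i) / weightedSum a n) atTop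
      (𝓝 l) := by
  have hlast := h.tendsto_mul_lastProb (by norm_num) ha
  rw [zero_add] at hlast
  simpa only [weightedSum_mul_lastProb, one_mul] using
    tendsto_weightedSum_mul_div ha hS (hlast.mul hz)

lemma abs_div_weightedSum_mul_le (ha : ∀ n, 1 ≤ n → 0 < a n) (t : ℝ) {n i : ℕ} (hi : 1 ≤ i)
    (hin : i ≤ n) : |t / weightedSum a n * a i| ≤ |t| * (a i / weightedSum a i) := by
  have hai := (ha i hi).le
  have hSi := weightedSum_pos ha hi
  rw [abs_mul, abs_div, abs_of_pos (weightedSum_pos ha (hi.trans hin)), abs_of_nonneg hai,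
    div_mul_eq_mul_div, mul_div_assoc]
  gcongr
  exact weightedSum_mono ha hin

lemma RegularlyVarying.exists_abs_div_weightedSum_le {α : ℝ} (hα : 0 ≤ α)
    (ha : ∀ n, 1 ≤ n → 0 < a n) (h : RegularlyVarying a α) (t : ℝ) :
    ∃ C, ∀ n i : ℕ, 1 ≤ i → i ≤ n → |t / weightedSum a n * a i| ≤ C := by
  obtain ⟨C, hC⟩ := (h.tendsto_div_weightedSum hα ha).bddAbove_range
  refine ⟨|t| * C, fun n i hi hin => (abs_div_weightedSum_mul_le ha t hi hin).trans ?_⟩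
  exact mul_le_mul_of_nonneg_left (hC ⟨i, rfl⟩) (abs_nonneg t)

lemma RegularlyVarying.exists_abs_sum_log_stepMGF_sub_le {α : ℝ} (hα : 0 ≤ α)
    (ha : ∀ n, 1 ≤ n → 0 < a n) (h : RegularlyVarying a α) (t : ℝ) :
    ∃ C, ∀ n : ℕ, |(∑ i ∈ Finset.Icc 1 n,
        Real.log (stepMGF (lastProb a i) (t / weightedSum a n * a i))) -
          t / 2 * ((∑ i ∈ Finset.Icc 1 n, lastProb a i * a i) / weightedSum a n)| ≤
      C * ((∑ i ∈ Finset.Icc 1 n, lastProb a i * a i * (a i / weightedSum a i)) /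
        weightedSum a n) := by
  obtain ⟨C, hC⟩ := h.exists_abs_div_weightedSum_le hα ha t
  refine ⟨2 * (|t| * |t|) * Real.exp (3 * C), fun n => ?_⟩
  rw [Finset.sum_div, Finset.sum_div, Finset.mul_sum, Finset.mul_sum, ← Finset.sum_sub_distrib]
  refine (Finset.abs_sum_le_sum_abs _ _).trans (Finset.sum_le_sum fun i hi => ?_)
  obtain ⟨hi₁, hin⟩ := Finset.mem_Icc.1 hi
  have hai := ha i hi₁
  have hSn := weightedSum_pos ha (hi₁.trans hin)
  have hp := (lastProb_mem_Icc ha i).1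
  have hx : |t / weightedSum a n * a i| = |t| * (a i / weightedSum a n) := by
    rw [abs_mul, abs_div, abs_of_pos hSn, abs_of_pos hai]
    ring
  have hxi := abs_div_weightedSum_mul_le ha t hi₁ hin
  have hxC := hC n i hi₁ hin
  have hlog := abs_log_stepMGF_sub_le (lastProb_mem_Icc ha i) (t / weightedSum a n * a i)
  set x := t / weightedSum a n * a i with hx_def
  calc |Real.log (stepMGF (lastProb a i) x) - t / 2 * (lastProb a i * a i / weightedSum a n)|
      = |Real.log (stepMGF (lastProb a i) x) - lastProb a i * x / 2| := by
        rw [hx_def]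
        ring_nf
    _ ≤ 2 * lastProb a i * (|x| * |x|) * Real.exp (3 * |x|) := by
        rwa [abs_mul_abs_self, ← sq]
    _ ≤ 2 * lastProb a i * (|x| * (|t| * (a i / weightedSum a i))) * Real.exp (3 * C) := by
        have : 0 ≤ a i / weightedSum a i := (div_pos hai (weightedSum_pos ha hi₁)).le
        gcongr
    _ = 2 * (|t| * |t|) * Real.exp (3 * C) *
          (lastProb a i * a i * (a i / weightedSum a i) / weightedSum a n) := by
        rw [hx]
        ring

lemma RegularlyVarying.tendsto_heightMGF_of_not_summable (ha : ∀ n, 1 ≤ n → 0 < a n)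
    (h : RegularlyVarying a 0) (hS : ¬ Summable fun i : ℕ => (i : ℝ)⁻¹ * a i) (t : ℝ) :
    Tendsto (fun n => heightMGF a n (t / weightedSum a n)) atTop (𝓝 (Real.exp (t / 2))) := by
  obtain ⟨C, hC⟩ := h.exists_abs_sum_log_stepMGF_sub_le le_rfl ha t
  have hmean := h.tendsto_sum_lastProb_mul_div ha hS (tendsto_const_nhds (x := 1))
  simp only [mul_one] at hmean
  have herror := h.tendsto_sum_lastProb_mul_div ha hS (h.tendsto_div_weightedSum le_rfl ha)
  have hdiff := squeeze_zero_norm (fun n => (Real.norm_eq_abs _).trans_le (hC n))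
    (by simpa using herror.const_mul C)
  have hlog := hdiff.add (hmean.const_mul (t / 2))
  simp only [sub_add_cancel, zero_add, mul_one] at hlog
  simpa only [heightMGF_eq_exp_sum_log ha, Function.comp_def] using
    (Real.continuous_exp.tendsto _).comp hlog

lemma tendsto_weightedSum_tsum (hS : Summable fun i : ℕ => (i : ℝ)⁻¹ * a i) :
    Tendsto (weightedSum a) atTop (𝓝 (∑' i : ℕ, (i : ℝ)⁻¹ * a i)) := by
  rw [funext (weightedSum_eq_sum_range a)]
  exact hS.hasSum.tendsto_sum_nat.comp (tendsto_add_atTop_nat 1)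

lemma tsum_inv_mul_pos (ha : ∀ n, 1 ≤ n → 0 < a n)
    (hS : Summable fun i : ℕ => (i : ℝ)⁻¹ * a i) : 0 < ∑' i : ℕ, (i : ℝ)⁻¹ * a i :=
  hS.tsum_pos (inv_mul_nonneg ha) 1 (by simpa using ha 1 le_rfl)

lemma tendsto_div_weightedSum_tsum (ha : ∀ n, 1 ≤ n → 0 < a n)
    (hS : Summable fun i : ℕ => (i : ℝ)⁻¹ * a i) (t : ℝ) :
    Tendsto (fun n => t / weightedSum a n) atTop (𝓝 (t / ∑' i : ℕ, (i : ℝ)⁻¹ * a i)) :=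
  tendsto_const_nhds.div (tendsto_weightedSum_tsum hS) (tsum_inv_mul_pos ha hS).ne'

lemma RegularlyVarying.exists_abs_log_stepMGF_le {α : ℝ} (hα : 0 ≤ α)
    (ha : ∀ n, 1 ≤ n → 0 < a n) (h : RegularlyVarying a α) (t : ℝ) :
    ∃ C, 0 ≤ C ∧ ∀ n i : ℕ, 1 ≤ i → i ≤ n →
      |Real.log (stepMGF (lastProb a i) (t / weightedSum a n * a i))| ≤
        C * ((i : ℝ)⁻¹ * a i) := by
  obtain ⟨C₁, hC₁, hlast⟩ := h.exists_lastProb_le (by linarith) ha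
  obtain ⟨C₂, hC₂⟩ := h.exists_abs_div_weightedSum_le hα ha t
  have ha₁ := ha 1 le_rfl
  refine ⟨C₁ * (|t| / a 1) * Real.exp (2 * C₂), by positivity, fun n i hi hin => ?_⟩
  have hn := hi.trans hin
  have hai := ha i hi
  have hx : |t / weightedSum a n * a i| ≤ |t| / a 1 * a i := by
    rw [abs_mul, abs_div, abs_of_pos (weightedSum_pos ha hn), abs_of_pos hai]
    gcongr
    exact le_weightedSum ha hn
  have hxC := hC₂ n i hi hin
  set x := t / weightedSum a n * a i
  calc |Real.log (stepMGF (lastProb a i) x)| ≤ lastProb a i * |x| * Real.exp (2 * |x|) :=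
        abs_log_stepMGF_le (lastProb_mem_Icc ha i) x
    _ ≤ C₁ * (i : ℝ)⁻¹ * (|t| / a 1 * a i) * Real.exp (2 * C₂) := by
        gcongr
        exact hlast i
    _ = C₁ * (|t| / a 1) * Real.exp (2 * C₂) * ((i : ℝ)⁻¹ * a i) := by ring

lemma RegularlyVarying.tendsto_heightMGF_of_summable {α : ℝ} (hα : 0 ≤ α)
    (ha : ∀ n, 1 ≤ n → 0 < a n) (h : RegularlyVarying a α)
    (hS : Summable fun i : ℕ => (i : ℝ)⁻¹ * a i) (t : ℝ) :
    Tendsto (fun n => heightMGF a n (t / weightedSum a n)) atTop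
      (𝓝 (Real.exp (∑' i, Real.log
        (stepMGF (lastProb a i) (t / (∑' i : ℕ, (i : ℝ)⁻¹ * a i) * a i))))) := by
  obtain ⟨C, hC, hbound⟩ := h.exists_abs_log_stepMGF_le hα ha t
  have hlim := tendsto_tsum_of_dominated_convergence (𝓕 := atTop)
    (f := fun n i => Set.indicator (Finset.Icc 1 n : Set ℕ) (fun i =>
      Real.log (stepMGF (lastProb a i) (t / weightedSum a n * a i))) i)
    (g := fun i => Real.log
      (stepMGF (lastProb a i) (t / (∑' i : ℕ, (i : ℝ)⁻¹ * a i) * a i)))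
    (hS.mul_left C) (fun i => ?_) (.of_forall fun n i => ?_)
  · refine ((Real.continuous_exp.tendsto _).comp hlim).congr fun n => ?_
    rw [heightMGF_eq_exp_sum_log ha, Function.comp, ← sum_eq_tsum_indicator]
  · rcases i.eq_zero_or_pos with rfl | hi
    · simp [lastProb_zero, stepMGF_zero_left]
    · have harg := (tendsto_div_weightedSum_tsum ha hS t).mul_const (a i)
      refine ((((continuous_stepMGF _).tendsto _).comp harg).log
        (stepMGF_pos (lastProb_mem_Icc ha i) _).ne').congr' ?_
      filter_upwards [eventually_ge_atTop i] with n hin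
      rw [Set.indicator_of_mem (Finset.mem_coe.2 (Finset.mem_Icc.2 ⟨hi, hin⟩)), Function.comp]
  · by_cases hi : i ∈ Finset.Icc 1 n
    · rw [Set.indicator_of_mem (Finset.mem_coe.2 hi), Real.norm_eq_abs]
      exact hbound n i (Finset.mem_Icc.1 hi).1 (Finset.mem_Icc.1 hi).2
    · rw [Set.indicator_of_notMem (mt Finset.mem_coe.1 hi), norm_zero]
      exact mul_nonneg hC (inv_mul_nonneg ha i)

lemma tendsto_atBot_of_tendsto_heightMGF (ha : ∀ n, 1 ≤ n → 0 < a n)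
    (hS : Summable fun i : ℕ => (i : ℝ)⁻¹ * a i) {M : ℝ → ℝ}
    (hM : ∀ t, Tendsto (fun n => heightMGF a n (t / weightedSum a n)) atTop (𝓝 (M t))) :
    Tendsto M atBot (𝓝 0) := by
  have harg : Tendsto (fun t => t / (∑' i : ℕ, (i : ℝ)⁻¹ * a i) * a 1) atBot atBot :=
    (tendsto_id.atBot_div_const (tsum_inv_mul_pos ha hS)).atBot_mul_const (ha 1 le_rfl)
  refine squeeze_zero' (.of_forall fun t => ?_) ?_ (tendsto_unifMGF_atBot.comp harg)
  · exact ge_of_tendsto' (hM t) fun n => (heightMGF_pos ha n _).le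
  · filter_upwards [eventually_le_atBot 0] with t ht
    refine le_of_tendsto_of_tendsto (hM t) ((continuous_unifMGF.tendsto _).comp
      ((tendsto_div_weightedSum_tsum ha hS t).mul_const (a 1))) ?_
    filter_upwards [eventually_ge_atTop 1] with n hn
    exact heightMGF_le_unifMGF ha hn
      (div_nonpos_of_nonpos_of_nonneg ht (weightedSum_pos ha hn).le)

end IndexZero

section Limits

variable {Ω : Type*} [MeasurableSpace Ω] {P : Measure Ω} {a : ℕ → ℝ} {Y X : ℕ → Ω → Pt} {α : ℝ}

lemma aemeasurable_height_div (hX : ∀ n, 1 ≤ n → UniformOnTree a P Y n (X n)) (n : ℕ) :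
    AEMeasurable (fun ω => height Y X n ω / weightedSum a n) P :=
  (aemeasurable_height hX n).div_const _

variable [IsProbabilityMeasure P]

lemma integrable_exp_height_div (ha : ∀ n, 1 ≤ n → 0 < a n) (hY : IsGluing a P Y)
    (hX : ∀ n, 1 ≤ n → UniformOnTree a P Y n (X n)) (n : ℕ) (t : ℝ) :
    Integrable (fun ω => Real.exp (t * (height Y X n ω / weightedSum a n))) P := by
  simpa only [mul_div_assoc', div_mul_eq_mul_div] using
    integrable_exp_height ha hY hX n (t / weightedSum a n)

lemma mgf_height_div (ha : ∀ n, 1 ≤ n → 0 < a n) (hY : IsGluing a P Y)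
    (hX : ∀ n, 1 ≤ n → UniformOnTree a P Y n (X n)) (n : ℕ) (t : ℝ) :
    mgf (fun ω => height Y X n ω / weightedSum a n) P t = heightMGF a n (t / weightedSum a n) := by
  rw [← mgf_height ha hY hX, mgf, mgf]
  simp only [mul_div_assoc', div_mul_eq_mul_div]

lemma IsXiLaw.eq {ν ν' : ProbabilityMeasure ℝ} (h : IsXiLaw α ν) (h' : IsXiLaw α ν') :
    ν = ν' := by
  have hint (t : ℝ) : Integrable (fun x : ℝ => Real.exp (t * x)) (ν : Measure ℝ) :=
    mgf_pos_iff.1 ((Real.exp_pos _).trans_eq (h t).symm)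
  have hlaw : (ν : Measure ℝ) = (ν' : Measure ℝ) :=
    measure_eq_of_mgf_eq hint fun t => (h t).trans (h' t).symm
  exact Subtype.ext hlaw

theorem tendstoInDistribution_height_of_isXiLaw (hα : 0 < α) (ha : ∀ n, 1 ≤ n → 0 < a n)
    (h : RegularlyVarying a α) (hY : IsGluing a P Y)
    (hX : ∀ n, 1 ≤ n → UniformOnTree a P Y n (X n)) {ν : ProbabilityMeasure ℝ}
    (hν : IsXiLaw α ν) :
    TendstoInDistribution (fun n ω => height Y X n ω / weightedSum a n) atTop
      (fun x : ℝ => α * x) (fun _ => P) (ν : Measure ℝ) := by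
  refine tendstoInDistribution_of_tendsto_mgf (aemeasurable_height_div hX)
    (integrable_exp_height_div ha hY hX) (by fun_prop) fun t => ?_
  have hmgf : mgf (fun x : ℝ => α * x) (ν : Measure ℝ) t = Real.exp (phi α (α * t)) := by
    rw [← hν, ← mgf_const_mul]
    rfl
  simpa only [mgf_height_div ha hY hX, hmgf] using h.tendsto_heightMGF_of_pos hα ha t

theorem existsUnique_isXiLaw (hα : 0 < α) (ha : ∀ n, 1 ≤ n → 0 < a n)
    (h : RegularlyVarying a α) (hY : IsGluing a P Y)
    (hX : ∀ n, 1 ≤ n → UniformOnTree a P Y n (X n)) :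
    ∃! ν : ProbabilityMeasure ℝ, IsXiLaw α ν := by
  obtain ⟨ν, -, hν⟩ := exists_tendstoInDistribution_of_tendsto_mgf
    (P := fun _ : ℕ => P) (X := fun n ω => α⁻¹ * (height Y X n ω / weightedSum a n))
    (M := fun t => Real.exp (phi α t))
    (fun n => (aemeasurable_height_div hX n).const_mul _)
    (fun n t => by simpa only [mul_assoc] using integrable_exp_height_div ha hY hX n (t * α⁻¹))
    (fun t => by
      simp only [mgf_const_mul, mgf_height_div ha hY hX]
      simpa only [mul_inv_cancel_left₀ hα.ne'] using h.tendsto_heightMGF_of_pos hα ha (α⁻¹ * t))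
  exact ⟨ν, fun t => (hν t).2, fun ν' hν' => hν'.eq fun t => (hν t).2⟩

theorem tendstoInMeasure_height_of_not_summable (ha : ∀ n, 1 ≤ n → 0 < a n)
    (h : RegularlyVarying a 0) (hY : IsGluing a P Y)
    (hX : ∀ n, 1 ≤ n → UniformOnTree a P Y n (X n))
    (hS : ¬ Summable fun i : ℕ => (i : ℝ)⁻¹ * a i) :
    TendstoInMeasure P (fun n ω => height Y X n ω / weightedSum a n) atTop fun _ => 1 / 2 := by
  refine tendstoInMeasure_of_tendstoInDistribution_const (P' := P)
    (tendstoInDistribution_of_tendsto_mgf (aemeasurable_height_div hX)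
      (integrable_exp_height_div ha hY hX) aemeasurable_const fun t => ?_)
  simpa only [mgf_height_div ha hY hX, mgf_const, mul_one_div] using
    h.tendsto_heightMGF_of_not_summable ha hS t

theorem exists_tendstoInDistribution_height_of_summable (hα : 0 ≤ α)
    (ha : ∀ n, 1 ≤ n → 0 < a n) (h : RegularlyVarying a α) (hY : IsGluing a P Y)
    (hX : ∀ n, 1 ≤ n → UniformOnTree a P Y n (X n))
    (hS : Summable fun i : ℕ => (i : ℝ)⁻¹ * a i) :
    ∃ ν : ProbabilityMeasure ℝ,
      (∀ᵐ x ∂(ν : Measure ℝ), 0 < x) ∧ Integrable (fun x : ℝ => x) (ν : Measure ℝ) ∧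
      TendstoInDistribution (fun n ω => height Y X n ω / weightedSum a n) atTop
        (fun x : ℝ => x) (fun _ => P) (ν : Measure ℝ) := by
  have hM := h.tendsto_heightMGF_of_summable hα ha hS
  obtain ⟨ν, hν, hmgf⟩ := exists_tendstoInDistribution_of_tendsto_mgf (aemeasurable_height_div hX)
    (integrable_exp_height_div ha hY hX)
    (fun t => by simpa only [mgf_height_div ha hY hX] using hM t)
  have hint (t : ℝ) := (hmgf t).1
  have hatBot : Tendsto (mgf (fun x : ℝ => x) (ν : Measure ℝ)) atBot (𝓝 0) :=
    (tendsto_atBot_of_tendsto_heightMGF ha hS hM).congr fun t => (hmgf t).2.symm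
  have huniv : integrableExpSet (fun x : ℝ => x) (ν : Measure ℝ) = Set.univ :=
    Set.eq_univ_of_forall hint
  exact ⟨ν, ae_pos_of_tendsto_mgf_atBot hint hatBot,
    integrable_of_mem_interior_integrableExpSet (by simp [huniv]), hν⟩

end Limits

end SegmentGluing

theorem mainTheorem3
    {Ω : Type*} [MeasurableSpace Ω] (P : Measure Ω) [IsProbabilityMeasure P]
    (a : ℕ → ℝ) (ha : ∀ n, 1 ≤ n → 0 < a n)
    (α : ℝ) (hα : 0 ≤ α) (hreg : SegmentGluing.RegularlyVarying a α)
    (Y : ℕ → Ω → SegmentGluing.Pt) (hY : SegmentGluing.IsGluing a P Y)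
    (X : ℕ → Ω → SegmentGluing.Pt)
    (hX : ∀ n, 1 ≤ n → SegmentGluing.UniformOnTree a P Y n (X n)) :
    (0 < α →
      (∃! ν : ProbabilityMeasure ℝ, SegmentGluing.IsXiLaw α ν) ∧
      ∀ ν : ProbabilityMeasure ℝ, SegmentGluing.IsXiLaw α ν →
        TendstoInDistribution
          (fun (n : ℕ) (ω : Ω) => SegmentGluing.height Y X n ω / SegmentGluing.weightedSum a n)
          atTop (fun x : ℝ => α * x) (fun _ => P) (ν : Measure ℝ)) ∧
    (α = 0 → ¬ Summable (fun i : ℕ => (i : ℝ)⁻¹ * a i) →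
      TendstoInMeasure P
        (fun (n : ℕ) (ω : Ω) => SegmentGluing.height Y X n ω / SegmentGluing.weightedSum a n)
        atTop (fun _ => 1 / 2)) ∧
    (α = 0 → Summable (fun i : ℕ => (i : ℝ)⁻¹ * a i) →
      ∃ ν : ProbabilityMeasure ℝ,
        (∀ᵐ x ∂(ν : Measure ℝ), 0 < x) ∧ Integrable (fun x : ℝ => x) (ν : Measure ℝ) ∧
        TendstoInDistribution
          (fun (n : ℕ) (ω : Ω) => SegmentGluing.height Y X n ω / SegmentGluing.weightedSum a n)
          atTop (fun x : ℝ => x) (fun _ => P) (ν : Measure ℝ)) := by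
  refine ⟨fun hpos => ⟨SegmentGluing.existsUnique_isXiLaw hpos ha hreg hY hX, fun ν hν =>
    SegmentGluing.tendstoInDistribution_height_of_isXiLaw hpos ha hreg hY hX hν⟩, ?_, ?_⟩
  · rintro rfl hS
    exact SegmentGluing.tendstoInMeasure_height_of_not_summable ha hreg hY hX hS
  · rintro - hS
    exact SegmentGluing.exists_tendstoInDistribution_height_of_summable hα ha hreg hY hX hS
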